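/- **Setting.** Let $V:\mathbb R^n\to\mathbb R$ and $b:\mathbb R^n\to\mathbb R^n$ satisfy: (A) $V\in C^2(\mathbb R^n)$ and $\lim_{|x|\to\infty}\langle\nabla V(x),x\rangle/|x|=+\infty$; (B) $b$ is not conservative (it is not the gradient of a function on $\mathbb R^n$), and $b$ is continuously differentiable and bounded, with bounded derivatives; (C) $\langle\nabla V(x),b(x)\rangle=0$ for every $x\in\mathbb R^n$. Set $c:=-\tfrac12\nabla V+b$. For $T>0$ let $H_T$ be the set of absolutely continuous paths $\varphi:[0,T]\to\mathbb R^n$ with $\int_0^T|\dot\varphi_t|^2\,dt<\infty$, and put $$\mathcal L_T(\varphi)=\frac2T\int_0^T\langle b(\varphi_t),\dot\varphi_t\rangle\,dt\qquad(\varphi\in H_T).$$ For $x,y\in\mathbb R^n$ and $q\in\mathbb R$ let $$S^{xy}_T(q)=\inf\Big\{\frac12\int_0^T|\dot\varphi_t-c(\varphi_t)|^2\,dt\;:\;\varphi\in H_T,\ \varphi_0=x,\ \varphi_T=y,\ \mathcal L_T(\varphi)=q\Big\}\in[0,+\infty],$$ $$S^x_T(q)=\inf_{y\in\mathbb R^n}S^{xy}_T(q),\qquad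 s^x(q)=\inf_{T>0}\frac1T\,S^{xx}_T(q).$$ **Theorem.** (i) The function $s^x$ takes values in $[0,+\infty)$ and does not depend on $x$; denote it by $s$. The function $s:\mathbb R\to[0,+\infty)$ is convex, for all $x\in\mathbb R^n$ and $q\in\mathbb R$ $$s(q)=\lim_{T\to\infty}\frac{S^{xx}_T(q)}{T},$$ and $s(q)-s(-q)=-q$ for all $q\in\mathbb R$. (ii) Let $\{x_T\}_{T>0}\subset\mathbb R^n$ be a bounded family and set $s_T(q):=T^{-1}S^{x_T}_T(q)$ for $T>0$, $q\in\mathbb R$. Then each $s_T$ takes values in $[0,+\infty)$, and $s_T$ $\Gamma$-converges to $s$ as $T\to\infty$; that is, for every sequence of positive numbers $T_k\to\infty$ and every $q\in\mathbb R$: for every sequence $q_k\to q$ one has $\liminf_{k}s_{T_k}(q_k)\ge s(q)$, and there is a sequence $q_k\to q$ with $\limsup_{k}s_{T_k}(q_k)\le s(q)$. -/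

import Mathlib

open Filter Topology MeasureTheory Set
open scoped ENNReal Gradient

noncomputable section

namespace GallavottiCohen

/-- The vector field `b` is conservative: it is the gradient of some function. -/
def IsConservative {n : ℕ} (b : EuclideanSpace ℝ (Fin n) → EuclideanSpace ℝ (Fin n)) : Prop :=
  ∃ U : EuclideanSpace ℝ (Fin n) → ℝ, ∀ x, HasGradientAt U (b x) x

/-- Condition (A): `V` is of class `C²` and `⟨∇V(x), x⟩ / |x| → +∞` as `|x| → ∞`. -/
structure ConditionA {n : ℕ} (V : EuclideanSpace ℝ (Fin n) → ℝ) : Prop where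
  contDiff : ContDiff ℝ 2 V
  tendsto : Tendsto (fun x => inner ℝ (∇ V x) x / ‖x‖)
    (Bornology.cobounded (EuclideanSpace ℝ (Fin n))) atTop

/-- Condition (B): `b` is not conservative, of class `C¹`, bounded, with bounded derivatives. -/
structure ConditionB {n : ℕ} (b : EuclideanSpace ℝ (Fin n) → EuclideanSpace ℝ (Fin n)) :
    Prop where
  not_conservative : ¬ IsConservative b
  contDiff : ContDiff ℝ 1 b
  bounded : ∃ M : ℝ, ∀ x, ‖b x‖ ≤ M
  bounded_deriv : ∃ M : ℝ, ∀ x, ‖fderiv ℝ b x‖ ≤ M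

/-- Condition (C): `∇V` and `b` are pointwise orthogonal. -/
def ConditionC {n : ℕ} (V : EuclideanSpace ℝ (Fin n) → ℝ)
    (b : EuclideanSpace ℝ (Fin n) → EuclideanSpace ℝ (Fin n)) : Prop :=
  ∀ x, inner ℝ (∇ V x) (b x) = 0

/-- The vector field `c = -(1/2) ∇V + b`. -/
def drift {n : ℕ} (V : EuclideanSpace ℝ (Fin n) → ℝ)
    (b : EuclideanSpace ℝ (Fin n) → EuclideanSpace ℝ (Fin n))
    (x : EuclideanSpace ℝ (Fin n)) : EuclideanSpace ℝ (Fin n) :=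
  -((1 / 2 : ℝ) • ∇ V x) + b x

/-- `H_T`: absolutely continuous paths on `[0,T]` with square integrable derivative. A path is
written as a function on `ℝ`, of which only the restriction to `[0,T]` is relevant here and below
(the derivative at the two endpoints does not matter for the integrals). -/
def pathsH (n : ℕ) (T : ℝ) : Set (ℝ → EuclideanSpace ℝ (Fin n)) :=
  {φ | AbsolutelyContinuousOnInterval φ 0 T ∧
    IntervalIntegrable (fun t => ‖deriv φ t‖ ^ 2) volume 0 T}

/-- `H^x_T`: the paths in `H_T` that start from `x`. -/
def pathsHFrom {n : ℕ} (T : ℝ) (x : EuclideanSpace ℝ (Fin n)) :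
    Set (ℝ → EuclideanSpace ℝ (Fin n)) :=
  {φ | φ ∈ pathsH n T ∧ φ 0 = x}

open Classical in
/-- The Freidlin-Wentzell functional
`I^x_T(φ) = (1/2) ∫₀ᵀ |φ'(t) - c(φ(t))|² dt` if `φ ∈ H^x_T`, and `+∞` otherwise. -/
def rateI {n : ℕ} (V : EuclideanSpace ℝ (Fin n) → ℝ)
    (b : EuclideanSpace ℝ (Fin n) → EuclideanSpace ℝ (Fin n)) (T : ℝ)
    (x : EuclideanSpace ℝ (Fin n)) (φ : ℝ → EuclideanSpace ℝ (Fin n)) : ℝ≥0∞ :=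
  if φ ∈ pathsHFrom T x then
    ENNReal.ofReal ((1 / 2) * ∫ t in (0 : ℝ)..T, ‖deriv φ t - drift V b (φ t)‖ ^ 2)
  else ⊤

/-- The power dissipated by `b`: `L_T(φ) = (2/T) ∫₀ᵀ ⟨b(φ(t)), φ'(t)⟩ dt` for `φ ∈ H_T`. -/
def power {n : ℕ} (b : EuclideanSpace ℝ (Fin n) → EuclideanSpace ℝ (Fin n)) (T : ℝ)
    (φ : ℝ → EuclideanSpace ℝ (Fin n)) : ℝ :=
  (2 / T) * ∫ t in (0 : ℝ)..T, inner ℝ (b (φ t)) (deriv φ t)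

/-- `A^{xy}_T(q)`: the paths in `H_T` from `x` to `y` that dissipate the power `q`. -/
def pathsA {n : ℕ} (b : EuclideanSpace ℝ (Fin n) → EuclideanSpace ℝ (Fin n)) (T : ℝ)
    (x y : EuclideanSpace ℝ (Fin n)) (q : ℝ) : Set (ℝ → EuclideanSpace ℝ (Fin n)) :=
  {φ | φ ∈ pathsHFrom T x ∧ φ T = y ∧ power b T φ = q}

/-- `S^{xy}_T(q) = inf {I^x_T(φ) : φ ∈ A^{xy}_T(q)}`, with `inf ∅ = +∞`. -/
def rateSTo {n : ℕ} (V : EuclideanSpace ℝ (Fin n) → ℝ)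
    (b : EuclideanSpace ℝ (Fin n) → EuclideanSpace ℝ (Fin n)) (T : ℝ)
    (x y : EuclideanSpace ℝ (Fin n)) (q : ℝ) : ℝ≥0∞ :=
  ⨅ φ ∈ pathsA b T x y q, rateI V b T x φ

/-- `S^x_T(q) = inf_y S^{xy}_T(q)`. -/
def rateS {n : ℕ} (V : EuclideanSpace ℝ (Fin n) → ℝ)
    (b : EuclideanSpace ℝ (Fin n) → EuclideanSpace ℝ (Fin n)) (T : ℝ)
    (x : EuclideanSpace ℝ (Fin n)) (q : ℝ) : ℝ≥0∞ :=
  ⨅ y : EuclideanSpace ℝ (Fin n), rateSTo V b T x y q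

/-- `s^x(q) = inf_{T > 0} S^{xx}_T(q) / T`. -/
def rateInf {n : ℕ} (V : EuclideanSpace ℝ (Fin n) → ℝ)
    (b : EuclideanSpace ℝ (Fin n) → EuclideanSpace ℝ (Fin n))
    (x : EuclideanSpace ℝ (Fin n)) (q : ℝ) : ℝ≥0∞ :=
  ⨅ (T : ℝ) (_ : 0 < T), rateSTo V b T x x q / ENNReal.ofReal T

/-- Sequential `Γ`-convergence of functions with values in `[0,+∞]`. -/
def GammaConverges {X : Type*} [TopologicalSpace X] (F : ℕ → X → ℝ≥0∞) (G : X → ℝ≥0∞) : Prop :=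
  ∀ x : X,
    (∀ u : ℕ → X, Tendsto u atTop (𝓝 x) → G x ≤ liminf (fun k => F k (u k)) atTop) ∧
    (∃ u : ℕ → X, Tendsto u atTop (𝓝 x) ∧ limsup (fun k => F k (u k)) atTop ≤ G x)

end GallavottiCohen

end

/-! ### Absolutely continuous functions with vector values. -/

namespace AbsolutelyContinuousOnInterval

/-! Expanding the square, the action of a path is ½∫(|φ'|² + |c(φ)|²), plus half the increment of
`V`, minus the circulation ∫⟨b(φ), φ'⟩ (`SqIntegrable.action_eq`). Dissipating the power q during
the time T means having circulation Tq/2. Unlike power, circulation is additive under concatenation,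
so `cost` is subadditive jointly in time and circulation.

Non-conservativity gives controllability. Some triangle has non-zero circulation; shrinking,
reversing and repeating it joins any two points of a ball with any bounded circulation at bounded
cost, for durations in a compact subset of (0,∞) (`exists_steers_bounded`). Such connections are
free per unit time in the long run, so a Fekete-type argument (`exists_cost_div_le`) makes the cost
rate of loops converge to its infimum, locally uniformly in the base point and with the same limit
for all of them. Sharing the time between two loops gives convexity. Reversing a loop keeps the
energy and flips the circulation, which gives the fluctuation relation.

For the Γ-liminf the end point is free and may be far away. A budget linear in T bounds the energy
linearly, so growth of |c| forces the path back to a fixed ball shortly before T. Stopping it there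
changes the power little, because `b` is bounded, and closing it up costs O(1)
(`exists_loopRate_sub_le`). The rate is continuous, being convex and finite, and absorbs the change
of power. For the Γ-limsup, loops and a constant sequence suffice. -/

theorem of_dist_le {X Y : Type*} [PseudoMetricSpace X] [PseudoMetricSpace Y] {f : ℝ → X}
    {g : ℝ → Y} {a b K : ℝ} (hg : AbsolutelyContinuousOnInterval g a b)
    (h : ∀ s ∈ uIcc a b, ∀ t ∈ uIcc a b, dist (f s) (f t) ≤ K * dist (g s) (g t)) :
    AbsolutelyContinuousOnInterval f a b := by
  have h0 : Tendsto (fun E : ℕ × (ℕ → ℝ × ℝ) ↦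
      K * ∑ i ∈ Finset.range E.1, dist (g (E.2 i).1) (g (E.2 i).2))
      (AbsolutelyContinuousOnInterval.totalLengthFilter ⊓
        𝓟 (AbsolutelyContinuousOnInterval.disjWithin a b)) (𝓝 0) := by
    simpa using Tendsto.const_mul K hg
  refine squeeze_zero' (Eventually.of_forall fun E ↦ Finset.sum_nonneg fun _ _ ↦ dist_nonneg)
    ?_ h0
  refine eventually_inf_principal.2 (Eventually.of_forall fun E hE ↦ ?_)
  rw [Finset.mul_sum]
  refine Finset.sum_le_sum fun i hi ↦ h _ (hE.1 i hi).1 _ (hE.1 i hi).2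

variable {E : Type*} [NormedAddCommGroup E]

theorem comp_lipschitzOnWith {F : Type*} [NormedAddCommGroup F] {f : ℝ → E} {g : E → F}
    {s : Set E} {a b : ℝ} {K : NNReal} (hg : LipschitzOnWith K g s)
    (hf : AbsolutelyContinuousOnInterval f a b) (hs : MapsTo f (uIcc a b) s) :
    AbsolutelyContinuousOnInterval (fun t ↦ g (f t)) a b :=
  hf.of_dist_le fun _ ht _ ht' ↦ hg.dist_le_mul _ (hs ht) _ (hs ht')

variable [NormedSpace ℝ E]

/-- Increments of the primitive of `f` are dominated by those of the primitive of `‖f‖`, which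
reduces the claim to real-valued functions. -/
theorem integral_of_intervalIntegrable {f : ℝ → E} {a b : ℝ}
    (hf : IntervalIntegrable f volume a b) (x : E) :
    AbsolutelyContinuousOnInterval (fun t ↦ x + ∫ s in a..t, f s) a b := by
  refine (hf.norm.absolutelyContinuousOnInterval_intervalIntegral
    (c := a) left_mem_uIcc).of_dist_le (K := 1) fun s hs t ht ↦ ?_
  have hi : ∀ u ∈ uIcc a b, ∀ w ∈ uIcc a b, IntervalIntegrable f volume u w :=
    fun u hu w hw ↦ hf.mono_set (uIcc_subset_uIcc hu hw)
  rw [dist_add_left, dist_eq_norm, Real.dist_eq, one_mul,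
    intervalIntegral.integral_interval_sub_left (hi _ left_mem_uIcc _ hs)
      (hi _ left_mem_uIcc _ ht),
    intervalIntegral.integral_interval_sub_left (hi _ left_mem_uIcc _ hs).norm
      (hi _ left_mem_uIcc _ ht).norm]
  exact intervalIntegral.norm_integral_le_abs_integral_norm

/-- The scalar fundamental theorem is applied to `inner ℝ e (f ·)` for each `e`; bounded variation
makes `f` itself differentiable a.e., which identifies the scalar derivatives. -/
theorem eq_add_integral_deriv {E : Type*} [NormedAddCommGroup E] [InnerProductSpace ℝ E]
    [FiniteDimensional ℝ E] {f : ℝ → E} {a b : ℝ}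
    (hf : AbsolutelyContinuousOnInterval f a b)
    (hi : IntervalIntegrable (deriv f) volume a b) {t : ℝ} (ht : t ∈ uIcc a b) :
    f t = f a + ∫ s in a..t, deriv f s := by
  have : CompleteSpace E := FiniteDimensional.complete ℝ E
  rw [← sub_eq_iff_eq_add']
  refine ext_inner_left ℝ fun e ↦ ?_
  have hsub : uIcc a t ⊆ uIcc a b := uIcc_subset_uIcc left_mem_uIcc ht
  have hft := hf.mono hsub
  have hg : AbsolutelyContinuousOnInterval (fun s ↦ inner ℝ e (f s)) a t :=
    comp_lipschitzOnWith (g := fun z ↦ inner ℝ e z)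
      ((innerSL ℝ e).lipschitz.lipschitzOnWith (s := univ)) hft (mapsTo_univ _ _)
  have hae := hft.boundedVariationOn.ae_differentiableAt_of_mem_uIcc
  have h1 := hg.integral_deriv_eq_sub
  have h2 : ∫ s in a..t, inner ℝ e (deriv f s) = inner ℝ e (∫ s in a..t, deriv f s) :=
    (innerSL ℝ e).intervalIntegral_comp_comm (hi.mono_set hsub)
  rw [← h2, inner_sub_right, ← h1]
  refine intervalIntegral.integral_congr_ae ?_
  filter_upwards [hae] with s hs hs'
  have hd := (hs (uIoc_subset_uIcc hs')).hasDerivAt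
  exact ((innerSL ℝ e).hasFDerivAt.comp_hasDerivAt s hd).deriv

end AbsolutelyContinuousOnInterval

noncomputable section

namespace GallavottiCohen

set_option linter.unusedSectionVars false

/-! ### Paths encoded by their velocities, and concatenation. -/

section Paths

variable {E : Type*} [NormedAddCommGroup E] [InnerProductSpace ℝ E]

/-- The path with velocity `v` that starts from `x`. -/
def traj (x : E) (v : ℝ → E) (t : ℝ) : E := x + ∫ s in (0 : ℝ)..t, v s

/-- Square integrable velocities on `[0,T]`. -/
def SqIntegrable (T : ℝ) (v : ℝ → E) : Prop := MemLp v 2 (volume.restrict (Ioc 0 T))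

@[simp] theorem traj_zero (x : E) (v : ℝ → E) : traj x v 0 = x := by simp [traj]

namespace SqIntegrable

variable {T S : ℝ} {v w : ℝ → E}

theorem intervalIntegrable (hv : SqIntegrable T v) (hT : 0 ≤ T) :
    IntervalIntegrable v volume 0 T :=
  (intervalIntegrable_iff_integrableOn_Ioc_of_le hT).2 (MemLp.integrable one_le_two hv)

theorem norm_sq (hv : SqIntegrable T v) (hT : 0 ≤ T) :
    IntervalIntegrable (fun t ↦ ‖v t‖ ^ 2) volume 0 T :=
  (intervalIntegrable_iff_integrableOn_Ioc_of_le hT).2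
    ((memLp_two_iff_integrable_sq_norm hv.aestronglyMeasurable).1 hv)

theorem mono (hv : SqIntegrable T v) (h : S ≤ T) : SqIntegrable S v :=
  MemLp.mono_measure (Measure.restrict_mono (Ioc_subset_Ioc_right h) le_rfl) hv

theorem integrable_inner (hv : SqIntegrable T v) (hw : SqIntegrable T w) (hT : 0 ≤ T) :
    IntervalIntegrable (fun t ↦ inner ℝ (v t) (w t)) volume 0 T := by
  refine (intervalIntegrable_iff_integrableOn_Ioc_of_le hT).2 ?_
  refine (((memLp_two_iff_integrable_sq_norm hv.aestronglyMeasurable).1 hv).add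
    ((memLp_two_iff_integrable_sq_norm hw.aestronglyMeasurable).1 hw)).mono'
    (hv.aestronglyMeasurable.inner hw.aestronglyMeasurable) (Eventually.of_forall fun t ↦ ?_)
  refine (norm_inner_le_norm _ _).trans ?_
  simp only [Pi.add_apply]
  nlinarith [sq_nonneg (‖v t‖ - ‖w t‖), sq_nonneg (‖v t‖ + ‖w t‖)]

theorem absolutelyContinuous (hv : SqIntegrable T v) (hT : 0 ≤ T) (x : E) :
    AbsolutelyContinuousOnInterval (traj x v) 0 T :=
  AbsolutelyContinuousOnInterval.integral_of_intervalIntegrable (hv.intervalIntegrable hT) x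

theorem continuousOn_traj (hv : SqIntegrable T v) (hT : 0 ≤ T) (x : E) :
    ContinuousOn (traj x v) (Icc 0 T) := by
  simpa [uIcc_of_le hT] using (hv.absolutelyContinuous hT x).continuousOn

theorem of_continuousOn {f : ℝ → E} (hf : ContinuousOn f (Icc 0 T)) : SqIntegrable T f := by
  obtain ⟨C, hC⟩ := isCompact_Icc.exists_bound_of_continuousOn hf
  refine MemLp.of_bound ((hf.mono Ioc_subset_Icc_self).aestronglyMeasurable measurableSet_Ioc)
    C ?_
  exact (ae_restrict_iff' measurableSet_Ioc).2
    (Eventually.of_forall fun t ht ↦ hC t (Ioc_subset_Icc_self ht))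

theorem comp_traj (hv : SqIntegrable T v) (hT : 0 ≤ T) (x : E) {c : E → E} (hc : Continuous c) :
    SqIntegrable T (fun t ↦ c (traj x v t)) :=
  of_continuousOn (hc.comp_continuousOn (hv.continuousOn_traj hT x))

theorem power_integrable (hv : SqIntegrable T v) (hT : 0 ≤ T) (x : E) {b : E → E}
    (hb : Continuous b) :
    IntervalIntegrable (fun t ↦ inner ℝ (b (traj x v t)) (v t)) volume 0 T :=
  (hv.comp_traj hT x hb).integrable_inner hv hT

theorem action_integrable (hv : SqIntegrable T v) (hT : 0 ≤ T) (x : E) {c : E → E}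
    (hc : Continuous c) :
    IntervalIntegrable (fun t ↦ ‖v t - c (traj x v t)‖ ^ 2) volume 0 T :=
  norm_sq (v := fun t ↦ v t - c (traj x v t)) (MemLp.sub hv (hv.comp_traj hT x hc)) hT

theorem hasDerivAt_traj [CompleteSpace E] (hv : SqIntegrable T v) (hT : 0 ≤ T) (x : E) :
    ∀ᵐ t, t ∈ uIoc 0 T → HasDerivAt (traj x v) (v t) t := by
  filter_upwards [(hv.intervalIntegrable hT).ae_hasDerivAt_integral] with t ht ht'
  exact (ht (uIoc_subset_uIcc ht') 0 left_mem_uIcc).const_add x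

end SqIntegrable

/-- Follow the velocity `v` during the time `T`, then the velocity `w`. -/
def followedBy (T : ℝ) (v w : ℝ → E) (t : ℝ) : E := (Iic T).piecewise v (fun t ↦ w (t - T)) t

section followedBy

variable {T S : ℝ} {v w : ℝ → E}

theorem followedBy_of_le {t : ℝ} (ht : t ≤ T) : followedBy T v w t = v t :=
  piecewise_eq_of_mem _ _ _ ht

theorem followedBy_of_lt {t : ℝ} (ht : T < t) : followedBy T v w t = w (t - T) :=
  piecewise_eq_of_notMem _ _ _ (notMem_Iic.2 ht)

theorem SqIntegrable.followedBy (hv : SqIntegrable T v) (hw : SqIntegrable S w) :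
    SqIntegrable (T + S) (followedBy T v w) := by
  refine MemLp.piecewise measurableSet_Iic ?_ ?_
  · rw [Measure.restrict_restrict measurableSet_Iic]
    refine MemLp.mono_measure (Measure.restrict_mono ?_ le_rfl) hv
    exact fun t ht ↦ ⟨ht.2.1, ht.1⟩
  · rw [Measure.restrict_restrict measurableSet_Iic.compl]
    have h := (measurePreserving_sub_right volume T).restrict_preimage
      (measurableSet_Ioc (a := 0) (b := S))
    refine MemLp.mono_measure (Measure.restrict_mono ?_ le_rfl)
      (MemLp.comp_measurePreserving hw h)
    rintro t ⟨ht1, ht2⟩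
    simp only [mem_compl_iff, mem_Iic, not_le, mem_Ioc, mem_preimage] at *
    constructor <;> linarith

theorem traj_followedBy_of_le (x : E) {t : ℝ} (ht : t ≤ T) (ht0 : 0 ≤ t) :
    traj x (followedBy T v w) t = traj x v t := by
  refine congrArg (x + ·) (intervalIntegral.integral_congr fun s hs ↦ ?_)
  rw [uIcc_of_le ht0] at hs
  exact followedBy_of_le (hs.2.trans ht)

theorem integral_followedBy_shift {F : Type*} [NormedAddCommGroup F] [NormedSpace ℝ F]
    {f g : ℝ → F} {t : ℝ} (ht : T ≤ t) (h : ∀ s ∈ Ioc T t, f s = g (s - T)) :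
    ∫ s in T..t, f s = ∫ s in (0 : ℝ)..(t - T), g s := by
  rw [← sub_self T, ← intervalIntegral.integral_comp_sub_right]
  refine intervalIntegral.integral_congr_ae (Eventually.of_forall fun s hs ↦ ?_)
  rw [uIoc_of_le ht] at hs
  exact h s hs

theorem traj_followedBy_of_ge (hv : SqIntegrable T v) (hw : SqIntegrable S w) (hT : 0 ≤ T)
    (hS : 0 ≤ S) (x : E) {t : ℝ} (ht : T ≤ t) (htS : t ≤ T + S) :
    traj x (followedBy T v w) t = traj (traj x v T) w (t - T) := by
  have hi := (hv.followedBy hw).intervalIntegrable (by linarith)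
  have h1 : IntervalIntegrable (followedBy T v w) volume 0 T :=
    hi.mono_set (by
      rw [uIcc_of_le hT, uIcc_of_le (by linarith)]
      exact Icc_subset_Icc_right (by linarith))
  have h2 : IntervalIntegrable (followedBy T v w) volume T t :=
    hi.mono_set (by
      rw [uIcc_of_le ht, uIcc_of_le (by linarith)]
      exact Icc_subset_Icc hT htS)
  have h3 := traj_followedBy_of_le (v := v) (w := w) x le_rfl hT
  rw [traj, ← intervalIntegral.integral_add_adjacent_intervals h1 h2, ← add_assoc]
  change traj x (followedBy T v w) T + _ = _
  rw [h3, integral_followedBy_shift ht fun s hs ↦ followedBy_of_lt (v := v) (w := w) hs.1]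
  rfl

theorem integral_traj_followedBy (hv : SqIntegrable T v) (hw : SqIntegrable S w) (hT : 0 ≤ T)
    (hS : 0 ≤ S) (x : E) (F : E → E → ℝ)
    (h1 : IntervalIntegrable (fun t ↦ F (traj x v t) (v t)) volume 0 T)
    (h2 : IntervalIntegrable (fun t ↦ F (traj x (followedBy T v w) t) (followedBy T v w t))
      volume 0 (T + S)) :
    ∫ t in (0 : ℝ)..(T + S), F (traj x (followedBy T v w) t) (followedBy T v w t) =
      (∫ t in (0 : ℝ)..T, F (traj x v t) (v t)) +
        ∫ t in (0 : ℝ)..S, F (traj (traj x v T) w t) (w t) := by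
  have hTS : T ≤ T + S := by linarith
  have h3 : IntervalIntegrable (fun t ↦ F (traj x (followedBy T v w) t) (followedBy T v w t))
      volume T (T + S) :=
    h2.mono_set (by
      rw [uIcc_of_le hTS, uIcc_of_le (by linarith)]
      exact Icc_subset_Icc_left hT)
  have h4 : EqOn (fun t ↦ F (traj x v t) (v t))
      (fun t ↦ F (traj x (followedBy T v w) t) (followedBy T v w t)) (uIcc 0 T) := by
    intro t ht
    rw [uIcc_of_le hT] at ht
    simp only [traj_followedBy_of_le x ht.2 ht.1, followedBy_of_le ht.2]
  rw [intervalIntegral.integral_congr h4, ← intervalIntegral.integral_add_adjacent_intervals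
    (h1.congr fun t ht ↦ h4 (uIoc_subset_uIcc ht)) h3]
  congr 1
  rw [integral_followedBy_shift (g := fun t ↦ F (traj (traj x v T) w t) (w t)) hTS,
    add_sub_cancel_left]
  intro s hs
  rw [traj_followedBy_of_ge hv hw hT hS x hs.1.le hs.2, followedBy_of_lt hs.1]

end followedBy

/-- Some path from `x` to `y` of duration `T` has circulation `Q = ∫ ⟨b(φ), φ'⟩` and action
`a = (1/2) ∫ |φ' - c(φ)|²`. -/
def Steers (b c : E → E) (T : ℝ) (x y : E) (Q a : ℝ) : Prop :=
  ∃ v : ℝ → E, SqIntegrable T v ∧ traj x v T = y ∧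
    (∫ t in (0 : ℝ)..T, inner ℝ (b (traj x v t)) (v t)) = Q ∧
    (1 / 2) * (∫ t in (0 : ℝ)..T, ‖v t - c (traj x v t)‖ ^ 2) = a

namespace Steers

variable {b c : E → E} {T S : ℝ} {x y z : E} {Q Q' a a' : ℝ}

theorem nonneg (h : Steers b c T x y Q a) (hT : 0 ≤ T) : 0 ≤ a := by
  obtain ⟨v, -, -, -, rfl⟩ := h
  have := intervalIntegral.integral_nonneg (μ := volume) hT
    (fun t _ ↦ sq_nonneg ‖v t - c (traj x v t)‖)
  positivity

/-- Circulation and action are integrals along the path, hence additive under concatenation. -/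
theorem trans (hb : Continuous b) (hc : Continuous c) (hT : 0 ≤ T) (hS : 0 ≤ S)
    (h : Steers b c T x y Q a) (h' : Steers b c S y z Q' a') :
    Steers b c (T + S) x z (Q + Q') (a + a') := by
  obtain ⟨v, hv, rfl, rfl, rfl⟩ := h
  obtain ⟨w, hw, rfl, rfl, rfl⟩ := h'
  have hvw := hv.followedBy hw
  have hTS : 0 ≤ T + S := by linarith
  refine ⟨followedBy T v w, hvw, ?_, ?_, ?_⟩
  · rw [traj_followedBy_of_ge hv hw hT hS x (by linarith) le_rfl, add_sub_cancel_left]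
  · exact integral_traj_followedBy hv hw hT hS x (fun p u ↦ inner ℝ (b p) u)
      (hv.power_integrable hT x hb) (hvw.power_integrable hTS x hb)
  · rw [integral_traj_followedBy hv hw hT hS x (fun p u ↦ ‖u - c p‖ ^ 2)
      (hv.action_integrable hT x hc) (hvw.action_integrable hTS x hc), mul_add]

theorem iterate (hb : Continuous b) (hc : Continuous c) (hT : 0 ≤ T)
    (h : Steers b c T x x Q a) (N : ℕ) : Steers b c (N * T) x x (N * Q) (N * a) := by
  induction N with
  | zero => exact ⟨0, by simp [SqIntegrable], by simp [traj], by simp, by simp⟩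
  | succ N ih =>
    have := ih.trans hb hc (by positivity) hT h
    convert this using 1 <;> push_cast <;> ring

end Steers

end Paths

/-! ### Straight segments, the energy identity and time reversal. -/

section SegmentsAndReversal

variable {E : Type*} [NormedAddCommGroup E] [InnerProductSpace ℝ E]

/-- The line integral of `b` along the segment from `x` to `y`. -/
def circ (b : E → E) (x y : E) : ℝ := ∫ s in (0 : ℝ)..1, inner ℝ (b (x + s • (y - x))) (y - x)

theorem continuous_circ {b : E → E} (hb : Continuous b) :
    Continuous fun p : E × E ↦ circ b p.1 p.2 := by
  refine intervalIntegral.continuous_parametric_intervalIntegral_of_continuous' ?_ 0 1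
  simp only [Function.uncurry_def]
  fun_prop

@[simp] theorem circ_self (b : E → E) (x : E) : circ b x x = 0 := by simp [circ]

theorem circ_symm (b : E → E) (x y : E) : circ b y x = -circ b x y := by
  have h := intervalIntegral.integral_comp_sub_left (a := 0) (b := 1)
    (fun s : ℝ ↦ inner ℝ (b (x + s • (y - x))) (y - x)) 1
  simp only [sub_self, sub_zero] at h
  rw [circ, circ, ← h, ← intervalIntegral.integral_neg]
  refine intervalIntegral.integral_congr fun s _ ↦ ?_
  have h1 : x + (1 - s) • (y - x) = y + s • (x - y) := by module
  change inner ℝ (b (y + s • (x - y))) (x - y) = -inner ℝ (b (x + (1 - s) • (y - x))) (y - x)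
  rw [h1, ← neg_sub y x, inner_neg_right]

theorem traj_const (x u : E) [CompleteSpace E] (t : ℝ) : traj x (fun _ ↦ u) t = x + t • u := by
  simp [traj]

/-- The segment is run at constant speed, at most 2R/T, inside a ball where |c| ≤ C; its circulation
does not depend on the parametrization. -/
theorem steers_segment [CompleteSpace E] {b c : E → E} {T R C : ℝ}
    (hT : 0 < T) {x y : E} (hx : ‖x‖ ≤ R) (hy : ‖y‖ ≤ R)
    (hC : ∀ z : E, ‖z‖ ≤ R → ‖c z‖ ≤ C) :
    ∃ a ≤ (1 / 2) * (T * (2 * R / T + C) ^ 2), Steers b c T x y (circ b x y) a := by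
  have hR : 0 ≤ R := (norm_nonneg x).trans hx
  have hv : SqIntegrable T fun _ : ℝ ↦ T⁻¹ • (y - x) :=
    SqIntegrable.of_continuousOn continuousOn_const
  refine ⟨_, ?_, _, hv, ?_, ?_, rfl⟩
  · have hbd : ∀ t ∈ uIoc 0 T,
        ‖‖T⁻¹ • (y - x) - c (traj x (fun _ ↦ T⁻¹ • (y - x)) t)‖ ^ 2‖ ≤ (2 * R / T + C) ^ 2 := by
      intro t ht
      rw [uIoc_of_le hT.le] at ht
      rw [Real.norm_of_nonneg (by positivity)]
      refine pow_le_pow_left₀ (norm_nonneg _) ((norm_sub_le _ _).trans (add_le_add ?_ ?_)) 2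
      · rw [norm_smul, norm_inv, Real.norm_of_nonneg hT.le, ← div_eq_inv_mul]
        gcongr
        exact (norm_sub_le _ _).trans (by linarith)
      · apply hC
        rw [traj_const, smul_smul]
        have hmem : x + (t * T⁻¹) • (y - x) ∈ Metric.closedBall (0 : E) R := by
          refine (convex_closedBall (0 : E) R).add_smul_sub_mem (by simpa using hx)
            (by simpa using hy) ⟨?_, ?_⟩
          · have := ht.1; positivity
          · rw [← div_eq_mul_inv]; exact (div_le_one hT).2 ht.2
        simpa using hmem
    have h := (Real.le_norm_self _).trans (intervalIntegral.norm_integral_le_of_norm_le_const hbd)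
    rw [sub_zero, abs_of_pos hT, mul_comm] at h
    linarith
  · rw [traj_const, smul_smul, mul_inv_cancel₀ hT.ne', one_smul, add_sub_cancel]
  · have h := intervalIntegral.integral_comp_mul_left (a := 0) (b := T)
      (fun s : ℝ ↦ inner ℝ (b (x + s • (y - x))) (y - x)) (inv_ne_zero hT.ne')
    rw [mul_zero, inv_mul_cancel₀ hT.ne', inv_inv] at h
    simp only [traj_const, smul_smul, inner_smul_right, intervalIntegral.integral_const_mul]
    simp only [mul_comm _ T⁻¹]
    rw [h, smul_eq_mul, inv_mul_cancel_left₀ hT.ne', circ]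

section Energy

variable [FiniteDimensional ℝ E] [CompleteSpace E] {b c : E → E} {V : E → ℝ} {T : ℝ}

/-- The path stays in a ball on which `V` is Lipschitz, so `V` along it is absolutely continuous and
the chain rule can be integrated. -/
theorem SqIntegrable.integral_inner_gradient {v : ℝ → E} (hv : SqIntegrable T v) (hT : 0 ≤ T)
    (x : E) (hV : ContDiff ℝ 1 V) :
    ∫ t in (0 : ℝ)..T, inner ℝ (∇ V (traj x v t)) (v t) = V (traj x v T) - V x := by
  have hac := hv.absolutelyContinuous hT x
  obtain ⟨R, hR⟩ := hac.exists_bound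
  obtain ⟨K, hK⟩ := (hV.contDiffOn (s := Metric.closedBall (0 : E) R)).exists_lipschitzOnWith
    one_ne_zero (convex_closedBall _ _) (isCompact_closedBall _ _)
  have hVac : AbsolutelyContinuousOnInterval (fun t ↦ V (traj x v t)) 0 T :=
    AbsolutelyContinuousOnInterval.comp_lipschitzOnWith hK hac
      fun t ht ↦ by simpa using hR t ht
  have h := hVac.integral_deriv_eq_sub
  rw [traj_zero] at h
  rw [← h]
  refine intervalIntegral.integral_congr_ae ?_
  filter_upwards [hv.hasDerivAt_traj hT x] with t ht ht'
  have hg := ((hV.differentiable one_ne_zero).differentiableAt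
    (x := traj x v t)).hasGradientAt.hasFDerivAt.comp_hasDerivAt t (ht ht')
  refine Eq.trans ?_ hg.deriv.symm
  simp

theorem continuous_gradient (hV : ContDiff ℝ 1 V) : Continuous (∇ V) :=
  (InnerProductSpace.toDual ℝ E).symm.continuous.comp (hV.continuous_fderiv one_ne_zero)

/-- The action is the time-symmetric energy plus boundary terms and the circulation. -/
theorem SqIntegrable.action_eq {v : ℝ → E} (hv : SqIntegrable T v) (hT : 0 ≤ T) (x : E)
    (hV : ContDiff ℝ 1 V) (hb : Continuous b)
    (hc : ∀ z, c z = -((1 / 2 : ℝ) • ∇ V z) + b z) :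
    (1 / 2) * (∫ t in (0 : ℝ)..T, ‖v t - c (traj x v t)‖ ^ 2) =
      (1 / 2) * (∫ t in (0 : ℝ)..T, ‖v t‖ ^ 2) +
      (1 / 2) * (∫ t in (0 : ℝ)..T, ‖c (traj x v t)‖ ^ 2) +
      (1 / 2) * (V (traj x v T) - V x) - ∫ t in (0 : ℝ)..T, inner ℝ (b (traj x v t)) (v t) := by
  have hgr := continuous_gradient hV
  have hcc : Continuous c := by
    rw [funext hc]; fun_prop
  rw [← hv.integral_inner_gradient hT x hV]
  have i1 := hv.norm_sq hT
  have i2 := (hv.comp_traj hT x hcc).norm_sq hT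
  have i3 := (hv.comp_traj hT x hgr).integrable_inner hv hT
  have i4 := hv.power_integrable hT x hb
  rw [← intervalIntegral.integral_const_mul, ← intervalIntegral.integral_const_mul,
    ← intervalIntegral.integral_const_mul, ← intervalIntegral.integral_const_mul,
    ← intervalIntegral.integral_add (i1.const_mul _) (i2.const_mul _),
    ← intervalIntegral.integral_add ((i1.const_mul _).add (i2.const_mul _)) (i3.const_mul _),
    ← intervalIntegral.integral_sub (((i1.const_mul _).add (i2.const_mul _)).add
      (i3.const_mul _)) i4]
  refine intervalIntegral.integral_congr fun t _ ↦ ?_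
  have : inner ℝ (v t) (c (traj x v t)) =
      -(1 / 2) * inner ℝ (∇ V (traj x v t)) (v t) + inner ℝ (b (traj x v t)) (v t) := by
    rw [hc, inner_add_right, inner_neg_right, inner_smul_right,
      real_inner_comm (v t), real_inner_comm (v t)]
    ring
  simp only [norm_sub_sq_real, this]
  ring

theorem SqIntegrable.reverse {v : ℝ → E} (hv : SqIntegrable T v) :
    SqIntegrable T fun t ↦ -v (T - t) := by
  have h := (Measure.measurePreserving_sub_left volume T).restrict_preimage
    (measurableSet_Ioc (a := 0) (b := T))
  have h2 : (fun t : ℝ ↦ T - t) ⁻¹' Ioc 0 T = Ico 0 T := by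
    rw [Set.preimage_const_sub_Ioc]; simp
  rw [h2] at h
  have h3 := (MemLp.comp_measurePreserving hv h).neg
  rw [restrict_Ico_eq_restrict_Ioc] at h3
  exact h3

theorem traj_reverse {v : ℝ → E} (hv : SqIntegrable T v) (hT : 0 ≤ T) (x : E) {t : ℝ}
    (ht : t ∈ Icc 0 T) :
    traj (traj x v T) (fun t ↦ -v (T - t)) t = traj x v (T - t) := by
  have hi := hv.intervalIntegrable hT
  have h1 : IntervalIntegrable v volume 0 (T - t) := hi.mono_set (by
    rw [uIcc_of_le hT, uIcc_of_le (by linarith [ht.2])]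
    exact Icc_subset_Icc_right (by linarith [ht.1]))
  have h2 : IntervalIntegrable v volume (T - t) T := hi.mono_set (by
    rw [uIcc_of_le hT, uIcc_of_le (by linarith [ht.1])]
    exact Icc_subset_Icc_left (by linarith [ht.2]))
  have h3 := intervalIntegral.integral_add_adjacent_intervals h1 h2
  simp only [traj, intervalIntegral.integral_neg, intervalIntegral.integral_comp_sub_left]
  rw [← h3, sub_zero]
  abel

/-- In `SqIntegrable.action_eq` both energy terms are invariant under time reversal, the `V` term
vanishes on a loop, and the circulation enters with coefficient -1 and changes sign. -/
theorem Steers.reverse_loop (hV : ContDiff ℝ 1 V) (hb : Continuous b)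
    (hc : ∀ z, c z = -((1 / 2 : ℝ) • ∇ V z) + b z) (hT : 0 ≤ T) {x : E} {Q a : ℝ}
    (h : Steers b c T x x Q a) : Steers b c T x x (-Q) (a + 2 * Q) := by
  obtain ⟨v, hv, hx, rfl, rfl⟩ := h
  have hw := hv.reverse
  have ht : ∀ t ∈ Icc 0 T, traj x (fun t ↦ -v (T - t)) t = traj x v (T - t) := fun t ht ↦ by
    have := traj_reverse hv hT x ht
    rwa [hx] at this
  have hrefl : ∀ f : ℝ → ℝ, ∫ t in (0 : ℝ)..T, f t = ∫ t in (0 : ℝ)..T, f (T - t) := fun f ↦ by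
    rw [intervalIntegral.integral_comp_sub_left, sub_self, sub_zero]
  have hend : traj x (fun t ↦ -v (T - t)) T = x := by
    rw [ht T ⟨hT, le_rfl⟩, sub_self, traj_zero]
  have hQ : ∫ t in (0 : ℝ)..T, inner ℝ (b (traj x (fun t ↦ -v (T - t)) t)) (-v (T - t)) =
      -∫ t in (0 : ℝ)..T, inner ℝ (b (traj x v t)) (v t) := by
    rw [hrefl fun t ↦ inner ℝ (b (traj x v t)) (v t), ← intervalIntegral.integral_neg]
    refine intervalIntegral.integral_congr fun t htm ↦ ?_
    rw [uIcc_of_le hT] at htm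
    simp only [ht t htm, inner_neg_right]
  refine ⟨_, hw, hend, hQ, ?_⟩
  rw [hw.action_eq hT x hV hb hc, hv.action_eq hT x hV hb hc, hend, hx, hQ]
  have h1 : ∫ t in (0 : ℝ)..T, ‖-v (T - t)‖ ^ 2 = ∫ t in (0 : ℝ)..T, ‖v t‖ ^ 2 := by
    rw [hrefl fun t ↦ ‖v t‖ ^ 2]; simp only [norm_neg]
  have h2 : ∫ t in (0 : ℝ)..T, ‖c (traj x (fun t ↦ -v (T - t)) t)‖ ^ 2 =
      ∫ t in (0 : ℝ)..T, ‖c (traj x v t)‖ ^ 2 := by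
    rw [hrefl fun t ↦ ‖c (traj x v t)‖ ^ 2]
    refine intervalIntegral.integral_congr fun t htm ↦ ?_
    rw [uIcc_of_le hT] at htm
    simp only [ht t htm]
  rw [h1, h2]
  ring

end Energy

end SegmentsAndReversal

/-! ### Controllability from non-conservativity. -/

section Loops

variable {E : Type*} [NormedAddCommGroup E] [InnerProductSpace ℝ E] [FiniteDimensional ℝ E]
  [CompleteSpace E]

/-- The circulation of `b` along the triangle with vertices `0`, `p`, `q`. -/
def triangleCirc (b : E → E) (p q : E) : ℝ := circ b 0 p + circ b p q + circ b q 0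

theorem continuous_triangleCirc {b : E → E} (hb : Continuous b) :
    Continuous fun z : E × E ↦ triangleCirc b z.1 z.2 := by
  have h := continuous_circ hb
  exact ((h.comp (continuous_const.prodMk continuous_fst)).add h).add
    (h.comp (continuous_snd.prodMk continuous_const))

theorem triangleCirc_swap (b : E → E) (p q : E) : triangleCirc b q p = -triangleCirc b p q := by
  rw [triangleCirc, triangleCirc, circ_symm b q 0, circ_symm b p q, circ_symm b 0 p]
  ring

/-- Poincaré's lemma: if triangles carry no circulation, the increment of the potential `circ b 0`
from x to x + u is the line integral over that short segment, where `b` is close to `b x`. -/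
theorem hasGradientAt_circ_of_triangleCirc_eq_zero {b : E → E} (hb : Continuous b)
    (h : ∀ p q, triangleCirc b p q = 0) (x : E) : HasGradientAt (circ b 0) (b x) x := by
  rw [hasGradientAt_iff_isLittleO_nhds_zero, Asymptotics.isLittleO_iff]
  intro ε hε
  obtain ⟨δ, hδ, hδ'⟩ := Metric.continuousAt_iff.1 (hb.continuousAt (x := x)) ε hε
  filter_upwards [Metric.ball_mem_nhds (0 : E) hδ] with u hu
  have h1 : circ b 0 (x + u) - circ b 0 x = circ b x (x + u) := by
    have := h x (x + u)
    rw [triangleCirc, circ_symm b 0 (x + u)] at this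
    linarith
  have h2 : circ b x (x + u) - inner ℝ (b x) u =
      ∫ s in (0 : ℝ)..1, inner ℝ (b (x + s • u) - b x) u := by
    simp only [circ, add_sub_cancel_left, inner_sub_left]
    rw [intervalIntegral.integral_sub]
    · simp
    · exact Continuous.intervalIntegrable (by fun_prop) _ _
    · exact intervalIntegrable_const
  rw [h1, h2]
  refine (intervalIntegral.norm_integral_le_of_norm_le_const (C := ε * ‖u‖) fun s hs ↦ ?_).trans
    (by simp)
  rw [uIoc_of_le zero_le_one] at hs
  refine (norm_inner_le_norm _ _).trans (mul_le_mul_of_nonneg_right ?_ (norm_nonneg _))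
  rw [← dist_eq_norm]
  refine (hδ' ?_).le
  rw [dist_eq_norm, add_sub_cancel_left, norm_smul, Real.norm_of_nonneg hs.1.le]
  rw [mem_ball_zero_iff] at hu
  nlinarith [norm_nonneg u, hs.2]

/-- A non-conservative field has triangles of every small circulation, in a fixed ball. -/
theorem exists_triangleCirc_eq {b : E → E} (hb : Continuous b)
    (hnc : ¬ ∃ U : E → ℝ, ∀ x, HasGradientAt U (b x) x) :
    ∃ ρ Γ : ℝ, 0 < Γ ∧ ∀ g, |g| ≤ Γ → ∃ p q : E, ‖p‖ ≤ ρ ∧ ‖q‖ ≤ ρ ∧ triangleCirc b p q = g := by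
  obtain ⟨p, q, hpq⟩ : ∃ p q, triangleCirc b p q ≠ 0 := by
    by_contra! h
    exact hnc ⟨_, hasGradientAt_circ_of_triangleCirc_eq_zero hb h⟩
  wlog hpos : 0 < triangleCirc b p q generalizing p q
  · refine this q p ?_ ?_ <;> rw [triangleCirc_swap]
    · simpa using hpq
    · have := lt_of_le_of_ne (not_lt.1 hpos) hpq
      linarith
  -- Shrinking the triangle to the origin moves its circulation continuously down to 0.
  have key : ∀ g ∈ Icc 0 (triangleCirc b p q), ∃ t ∈ Icc (0 : ℝ) 1,
      triangleCirc b (t • p) (t • q) = g := by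
    have hcont : ContinuousOn (fun t : ℝ ↦ triangleCirc b (t • p) (t • q)) (Icc 0 1) := by
      refine Continuous.continuousOn ?_
      exact (continuous_triangleCirc hb).comp (by fun_prop : Continuous fun t : ℝ ↦ (t • p, t • q))
    intro g hg
    exact intermediate_value_Icc zero_le_one hcont (by simpa [triangleCirc] using hg)
  have hn : ∀ t ∈ Icc (0 : ℝ) 1, ∀ z : E, ‖z‖ ≤ max ‖p‖ ‖q‖ → ‖t • z‖ ≤ max ‖p‖ ‖q‖ := by
    intro t ht z hz
    rw [norm_smul, Real.norm_of_nonneg ht.1]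
    exact (mul_le_of_le_one_left (norm_nonneg z) ht.2).trans hz
  refine ⟨max ‖p‖ ‖q‖, triangleCirc b p q, hpos, fun g hg ↦ ?_⟩
  rcases le_total 0 g with h0 | h0
  · obtain ⟨t, ht, htg⟩ := key g ⟨h0, (le_abs_self g).trans hg⟩
    exact ⟨t • p, t • q, hn t ht p (le_max_left _ _), hn t ht q (le_max_right _ _), htg⟩
  · obtain ⟨t, ht, htg⟩ := key (-g) ⟨by linarith, (neg_le_abs g).trans hg⟩
    refine ⟨t • q, t • p, hn t ht q (le_max_right _ _), hn t ht p (le_max_left _ _), ?_⟩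
    rw [triangleCirc_swap, htg, neg_neg]

/-- Any two points of a ball can be joined with any bounded circulation, at bounded cost. -/
theorem exists_steers_bounded {b c : E → E} (hb : Continuous b) (hc : Continuous c)
    (hnc : ¬ ∃ U : E → ℝ, ∀ x, HasGradientAt U (b x) x) (R : ℝ) {r₀ : ℝ} (hr₀ : 0 < r₀)
    (r₁ M : ℝ) :
    ∃ C, ∀ x y : E, ‖x‖ ≤ R → ‖y‖ ≤ R → ∀ r ∈ Icc r₀ r₁, ∀ Q, |Q| ≤ M →
      ∃ a ≤ C, Steers b c r x y Q a := by
  obtain ⟨ρ, Γ, hΓ, hloop⟩ := exists_triangleCirc_eq hb hnc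
  set R' := max 0 (max R ρ)
  have hR' : 0 ≤ R' := le_max_left _ _
  have hRR' : R ≤ R' := (le_max_left _ _).trans (le_max_right _ _)
  have hρR' : ρ ≤ R' := (le_max_right _ _).trans (le_max_right _ _)
  obtain ⟨C, hC⟩ := (isCompact_closedBall (0 : E) R').exists_bound_of_continuousOn hc.continuousOn
  replace hC : ∀ z : E, ‖z‖ ≤ R' → ‖c z‖ ≤ C := fun z hz ↦ hC z (by simpa using hz)
  have hC0 : 0 ≤ C := (norm_nonneg _).trans (hC 0 (by simpa using hR'))
  obtain ⟨B, hB⟩ := (isCompact_closedBall (0 : E) R').exists_bound_of_continuousOn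
    ((continuous_circ hb).comp (by fun_prop : Continuous fun z : E ↦ ((0 : E), z))).continuousOn
  replace hB : ∀ z : E, ‖z‖ ≤ R' → |circ b 0 z| ≤ B := fun z hz ↦ hB z (by simpa using hz)
  -- N laps share the missing circulation, at most M + 2B in absolute value, so that each one needs
  -- at most Γ.
  obtain ⟨N, hN⟩ := exists_nat_ge (max 1 ((M + 2 * B) / Γ))
  have hN1 : (1 : ℝ) ≤ N := (le_max_left _ _).trans hN
  have hNΓ : M + 2 * B ≤ N * Γ := (div_le_iff₀ hΓ).1 ((le_max_right _ _).trans hN)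
  -- Number of segments: N triangles based at 0, one segment from x to 0 and one from 0 to y. Each
  -- lasts r / K and costs at most D.
  set K : ℝ := 3 * N + 2
  have hK : 0 < K := by positivity
  set D : ℝ := (1 / 2) * (r₁ / K * (2 * R' / (r₀ / K) + C) ^ 2)
  have hseg : ∀ r ∈ Icc r₀ r₁, ∀ x y : E, ‖x‖ ≤ R' → ‖y‖ ≤ R' →
      ∃ a ≤ D, Steers b c (r / K) x y (circ b x y) a := by
    intro r hr x y hx hy
    have hr0 : 0 < r := hr₀.trans_le hr.1
    obtain ⟨a, ha, h⟩ := steers_segment (b := b) (div_pos hr0 hK) hx hy hC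
    refine ⟨a, ha.trans ?_, h⟩
    have h1 := hr.1
    have h2 := hr.2
    have h3 : 0 ≤ r₁ := hr0.le.trans h2
    simp only [D]
    gcongr
  refine ⟨K * D, fun x y hx hy r hr Q hQ ↦ ?_⟩
  have hθ : 0 ≤ r / K := (div_pos (hr₀.trans_le hr.1) hK).le
  have hx' := hx.trans hRR'
  have hy' := hy.trans hRR'
  have h0 : ‖(0 : E)‖ ≤ R' := by simpa using hR'
  obtain ⟨p, q, hp, hq, hpq⟩ := hloop ((Q - circ b x 0 - circ b 0 y) / N) (by
    rw [abs_div, div_le_iff₀ (by positivity), Nat.abs_cast, circ_symm b 0 x]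
    have h1 := abs_le.1 (hB x hx')
    have h2 := abs_le.1 (hB y hy')
    have h3 := abs_le.1 hQ
    rw [abs_le]
    constructor <;> linarith [h1.1, h1.2, h2.1, h2.2, h3.1, h3.2])
  replace hp := hp.trans hρR'
  replace hq := hq.trans hρR'
  obtain ⟨a₁, ha₁, h₁⟩ := hseg r hr x 0 hx' h0
  obtain ⟨a₂, ha₂, h₂⟩ := hseg r hr 0 y h0 hy'
  obtain ⟨a₃, ha₃, h₃⟩ := hseg r hr 0 p h0 hp
  obtain ⟨a₄, ha₄, h₄⟩ := hseg r hr p q hp hq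
  obtain ⟨a₅, ha₅, h₅⟩ := hseg r hr q 0 hq h0
  have hl := (((h₃.trans hb hc hθ hθ h₄).trans hb hc (by positivity) hθ h₅).iterate hb hc
    (by positivity) N)
  have hall := (h₁.trans hb hc hθ (by positivity) hl).trans hb hc (by positivity) hθ h₂
  refine ⟨a₁ + N * (a₃ + a₄ + a₅) + a₂, ?_, ?_⟩
  · have : (N : ℝ) * (a₃ + a₄ + a₅) ≤ N * (D + D + D) := by gcongr
    simp only [K]
    linarith
  · convert hall using 1
    · simp only [K]; field_simp; ring
    · change triangleCirc b p q = _ at hpq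
      change Q = circ b x 0 + N * triangleCirc b p q + circ b 0 y
      rw [hpq]; field_simp; ring

end Loops

/-! ### Consequences of the growth of `V`. -/

section Coercivity

variable {n : ℕ} {V : EuclideanSpace ℝ (Fin n) → ℝ}
  {b : EuclideanSpace ℝ (Fin n) → EuclideanSpace ℝ (Fin n)}

theorem ConditionA.exists_radius (hA : ConditionA V) (K : ℝ) :
    ∃ R : ℝ, 0 < R ∧ ∀ x, R < ‖x‖ → K ≤ inner ℝ (∇ V x) x / ‖x‖ := by
  obtain ⟨R, -, hR⟩ := (Metric.hasBasis_cobounded_compl_closedBall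
    (0 : EuclideanSpace ℝ (Fin n))).eventually_iff.1 (hA.tendsto.eventually_ge_atTop K)
  refine ⟨max R 1, by positivity, fun x hx ↦ hR ?_⟩
  have := (le_max_left R 1).trans_lt hx
  simpa using this

/-- Outside a large ball `V` is nondecreasing along rays, so its minimum over the ball is global. -/
theorem ConditionA.exists_lower_bound (hA : ConditionA V) : ∃ m, ∀ x, m ≤ V x := by
  obtain ⟨R, hR0, hR⟩ := hA.exists_radius 0
  have hV : Differentiable ℝ V := hA.contDiff.differentiable two_ne_zero
  obtain ⟨x₀, -, hx₀⟩ := (isCompact_closedBall (0 : EuclideanSpace ℝ (Fin n)) R).exists_isMinOn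
    ⟨0, by simpa using hR0.le⟩ hA.contDiff.continuous.continuousOn
  have hball : ∀ x, ‖x‖ ≤ R → V x₀ ≤ V x := fun x hx ↦ isMinOn_iff.1 hx₀ x (by simpa using hx)
  refine ⟨V x₀, fun x ↦ ?_⟩
  rcases le_or_gt ‖x‖ R with hx | hx
  · exact hball x hx
  have hx0 : 0 < ‖x‖ := hR0.trans hx
  have hd : ∀ t : ℝ, HasDerivAt (fun t : ℝ ↦ V (t • x)) (inner ℝ (∇ V (t • x)) x) t := by
    intro t
    have h1 : HasDerivAt (fun t : ℝ ↦ t • x) x t := by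
      simpa using (hasDerivAt_id t).smul_const x
    have h2 := (hV (t • x)).hasGradientAt.hasFDerivAt.comp_hasDerivAt t h1
    simpa using! h2
  have hRx : R / ‖x‖ ≤ 1 := (div_le_one hx0).2 hx.le
  have hmono : MonotoneOn (fun t : ℝ ↦ V (t • x)) (Icc (R / ‖x‖) 1) := by
    refine monotoneOn_of_deriv_nonneg (convex_Icc _ _)
      (fun t _ ↦ (hd t).continuousAt.continuousWithinAt)
      (fun t _ ↦ (hd t).differentiableAt.differentiableWithinAt) fun t ht ↦ ?_
    rw [interior_Icc] at ht
    have ht0 : 0 < t := (by positivity : 0 < R / ‖x‖).trans ht.1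
    rw [(hd t).deriv]
    have hn : R < ‖t • x‖ := by
      rw [norm_smul, Real.norm_of_nonneg ht0.le]
      exact (div_lt_iff₀ hx0).1 ht.1
    have h3 := hR _ hn
    rw [inner_smul_right] at h3
    have h4 := (div_nonneg_iff.1 h3).resolve_right fun h ↦ by linarith [h.2]
    exact nonneg_of_mul_nonneg_right h4.1 ht0
  have h5 := hmono ⟨le_rfl, hRx⟩ ⟨hRx, le_rfl⟩ hRx
  simp only [one_smul] at h5
  refine (hball _ ?_).trans h5
  rw [norm_smul, Real.norm_of_nonneg (by positivity), div_mul_cancel₀ _ hx0.ne']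

/-- |∇V| is at least ⟨∇V(x), x⟩/|x|, which tends to infinity, and the bounded field `b` cannot
compensate it. -/
theorem ConditionA.exists_le_norm_drift_sq (hA : ConditionA V) {M : ℝ} (hb : ∀ x, ‖b x‖ ≤ M)
    (W : ℝ) : ∃ R, ∀ x, R < ‖x‖ → W ≤ ‖drift V b x‖ ^ 2 := by
  obtain ⟨R, hR0, hR⟩ := hA.exists_radius (2 * (M + |W| + 1))
  refine ⟨R, fun x hx ↦ ?_⟩
  have h1 : 2 * (M + |W| + 1) ≤ ‖∇ V x‖ := by
    refine (hR x hx).trans ?_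
    rw [div_le_iff₀ (hR0.trans hx)]
    exact real_inner_le_norm _ _
  have h2 : ‖(1 / 2 : ℝ) • ∇ V x‖ ≤ ‖drift V b x‖ + ‖b x‖ := by
    have : (1 / 2 : ℝ) • ∇ V x = b x - drift V b x := by rw [drift]; abel
    rw [this, add_comm]
    exact norm_sub_le _ _
  rw [norm_smul, Real.norm_of_nonneg (by norm_num)] at h2
  have h3 : |W| + 1 ≤ ‖drift V b x‖ := by linarith [hb x]
  nlinarith [abs_nonneg W, le_abs_self W]

end Coercivity

/-! ### Return to a compact set near the final time. -/

section Truncation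

variable {E : Type*} [NormedAddCommGroup E] [InnerProductSpace ℝ E] [FiniteDimensional ℝ E]
  [CompleteSpace E] {b c : E → E} {V : E → ℝ}

/-- A path whose cost is at most proportional to its duration returns to a fixed ball near the end
of its time interval; stopping it there changes its circulation little. -/
theorem exists_steers_truncation (hV : ContDiff ℝ 1 V) (hb : Continuous b)
    (hcV : ∀ z, c z = -((1 / 2 : ℝ) • ∇ V z) + b z) {M m : ℝ} (hbM : ∀ x, ‖b x‖ ≤ M)
    (hm : ∀ x, m ≤ V x) (hcoer : ∀ W, ∃ R, ∀ x, R < ‖x‖ → W ≤ ‖c x‖ ^ 2)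
    (A R₀ : ℝ) {η : ℝ} (hη : 0 < η) (hη1 : η ≤ 1) :
    ∃ R, ∀ T, 1 ≤ T → ∀ x, ‖x‖ ≤ R₀ → ∀ y Q a, Steers b c T x y Q a → a ≤ A * T → |Q| ≤ A * T →
      ∃ τ ∈ Icc ((1 - η) * T) T, ∃ y' Q' a', ‖y'‖ ≤ R ∧ Steers b c τ x y' Q' a' ∧ a' ≤ a ∧
        |Q - Q'| ≤ η * T := by
  have hc : Continuous c := by
    have := continuous_gradient hV
    rw [funext hcV]; fun_prop
  have hM : 0 ≤ M := (norm_nonneg _).trans (hbM 0)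
  obtain ⟨L, hL⟩ := (isCompact_closedBall (0 : E) R₀).exists_bound_of_continuousOn
    hV.continuous.continuousOn
  -- By `SqIntegrable.action_eq` the energy is 2a + 2Q minus the increment of `V`, hence at most
  -- 4|A|T + |L - m|T, as T ≥ 1. The extra 2 keeps B positive.
  set B : ℝ := 2 * (2 * |A| + (1 / 2) * |L - m| + 1)
  have hB : 0 < B := by positivity
  -- θ is the weight in Young's inequality M|v| ≤ θ|v|² + M²/(4θ). It makes the first term
  -- contribute at most ηT/2; the second entry of ε does the same for the other term over a window
  -- of length εT.
  set θ : ℝ := η / (2 * B)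
  have hθ : 0 < θ := by positivity
  set ε : ℝ := min η (2 * θ * η / (M ^ 2 + 1))
  have hε : 0 < ε := lt_min hη (by positivity)
  -- Staying outside this ball during the last εT would give ∫|c|² ≥ 2BT, twice the available
  -- energy.
  obtain ⟨R, hR⟩ := hcoer (2 * B / ε)
  refine ⟨R, ?_⟩
  rintro T hT x hx _ _ _ ⟨v, hv, rfl, rfl, rfl⟩ ha hQ
  have hT0 : 0 ≤ T := by linarith
  have hεη : ε ≤ η := min_le_left _ _
  have hεT : 0 ≤ (1 - ε) * T := mul_nonneg (by linarith) hT0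
  have hεT' : (1 - ε) * T ≤ T := by nlinarith
  have iv := hv.norm_sq hT0
  have ic := (hv.comp_traj hT0 x hc).norm_sq hT0
  have iq := hv.power_integrable hT0 x hb
  have ia := hv.action_integrable hT0 x hc
  have nv := intervalIntegral.integral_nonneg (μ := volume) hT0 (fun t _ ↦ sq_nonneg ‖v t‖)
  have nc := intervalIntegral.integral_nonneg (μ := volume) hT0
    (fun t _ ↦ sq_nonneg ‖c (traj x v t)‖)
  have hen : (∫ t in (0 : ℝ)..T, ‖v t‖ ^ 2) + (∫ t in (0 : ℝ)..T, ‖c (traj x v t)‖ ^ 2)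
      ≤ B * T := by
    have h1 := hv.action_eq hT0 x hV hb hcV
    have h2 := hm (traj x v T)
    have h3 := (Real.le_norm_self _).trans (hL x (by simpa using hx))
    have h4 := (le_abs_self _).trans hQ
    have h5 : A * T ≤ |A| * T := by gcongr; exact le_abs_self A
    have h6 : L - m ≤ |L - m| * T := (le_abs_self _).trans (by nlinarith [abs_nonneg (L - m)])
    simp only [B]
    linarith
  obtain ⟨τ, hτ, hτR⟩ : ∃ τ ∈ Icc ((1 - ε) * T) T, ‖traj x v τ‖ ≤ R := by
    by_contra! hcon
    have h1 : ∫ t in ((1 - ε) * T)..T, (2 * B / ε : ℝ) ≤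
        ∫ t in ((1 - ε) * T)..T, ‖c (traj x v t)‖ ^ 2 := by
      refine intervalIntegral.integral_mono_on hεT' intervalIntegrable_const ?_
        fun t ht ↦ hR _ (hcon t ht)
      exact ic.mono_set (by
        rw [uIcc_of_le hεT', uIcc_of_le hT0]
        exact Icc_subset_Icc_left hεT)
    have h2 : ∫ t in ((1 - ε) * T)..T, ‖c (traj x v t)‖ ^ 2 ≤
        ∫ t in (0 : ℝ)..T, ‖c (traj x v t)‖ ^ 2 :=
      intervalIntegral.integral_mono_interval hεT hεT' le_rfl
        (Eventually.of_forall fun t ↦ sq_nonneg _) ic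
    rw [intervalIntegral.integral_const, smul_eq_mul,
      show (T - (1 - ε) * T) * (2 * B / ε) = 2 * B * T by field_simp; ring] at h1
    nlinarith
  have hτ0 : 0 ≤ τ := hεT.trans hτ.1
  have hsub : ∀ {f : ℝ → ℝ}, IntervalIntegrable f volume 0 T → IntervalIntegrable f volume τ T :=
    fun hf ↦ hf.mono_set (by
      rw [uIcc_of_le hτ.2, uIcc_of_le hT0]
      exact Icc_subset_Icc_left hτ0)
  have hsub' : ∀ {f : ℝ → ℝ}, IntervalIntegrable f volume 0 T → IntervalIntegrable f volume 0 τ :=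
    fun hf ↦ hf.mono_set (by
      rw [uIcc_of_le hτ0, uIcc_of_le hT0]
      exact Icc_subset_Icc_right hτ.2)
  refine ⟨τ, ⟨le_trans (by gcongr) hτ.1, hτ.2⟩, traj x v τ, _, _, hτR,
    ⟨v, hv.mono hτ.2, rfl, rfl, rfl⟩, ?_, ?_⟩
  · refine mul_le_mul_of_nonneg_left ?_ (by norm_num)
    exact intervalIntegral.integral_mono_interval le_rfl hτ0 hτ.2
      (Eventually.of_forall fun t ↦ sq_nonneg _) ia
  · rw [intervalIntegral.integral_interval_sub_left iq (hsub' iq)]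
    have h1 : |∫ t in τ..T, inner ℝ (b (traj x v t)) (v t)| ≤
        ∫ t in τ..T, (θ * ‖v t‖ ^ 2 + M ^ 2 / (4 * θ)) := by
      refine (intervalIntegral.abs_integral_le_integral_abs hτ.2).trans ?_
      refine intervalIntegral.integral_mono_on hτ.2 (hsub iq).abs
        (((hsub iv).const_mul _).add intervalIntegrable_const) fun t _ ↦ ?_
      refine (abs_real_inner_le_norm _ _).trans
        ((mul_le_mul_of_nonneg_right (hbM _) (norm_nonneg _)).trans ?_)
      rw [← sub_nonneg]
      have : θ * ‖v t‖ ^ 2 + M ^ 2 / (4 * θ) - M * ‖v t‖ =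
          (2 * θ * ‖v t‖ - M) ^ 2 / (4 * θ) := by field_simp; ring
      rw [this]; positivity
    rw [intervalIntegral.integral_add ((hsub iv).const_mul _) intervalIntegrable_const,
      intervalIntegral.integral_const_mul, intervalIntegral.integral_const, smul_eq_mul] at h1
    have h2 : ∫ t in τ..T, ‖v t‖ ^ 2 ≤ ∫ t in (0 : ℝ)..T, ‖v t‖ ^ 2 :=
      intervalIntegral.integral_mono_interval hτ0 hτ.2 le_rfl
        (Eventually.of_forall fun t ↦ sq_nonneg _) iv
    have h3 : θ * ∫ t in τ..T, ‖v t‖ ^ 2 ≤ η / 2 * T := by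
      calc θ * ∫ t in τ..T, ‖v t‖ ^ 2 ≤ θ * (B * T) := by gcongr; linarith
        _ = η / 2 * T := by simp only [θ]; field_simp
    have h4 : (T - τ) * (M ^ 2 / (4 * θ)) ≤ η / 2 * T := by
      calc (T - τ) * (M ^ 2 / (4 * θ)) ≤ (2 * θ * η / (M ^ 2 + 1) * T) * (M ^ 2 / (4 * θ)) := by
            gcongr
            have : ε * T ≤ 2 * θ * η / (M ^ 2 + 1) * T := by gcongr; exact min_le_right _ _
            linarith [hτ.1]
        _ = η / 2 * T * (M ^ 2 / (M ^ 2 + 1)) := by field_simp; ring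
        _ ≤ η / 2 * T * 1 := by
            gcongr
            exact (div_le_one (by positivity)).2 (by linarith)
        _ = _ := mul_one _
    linarith

end Truncation

/-! ### Dictionary between `pathsA` and `Steers`: power q becomes circulation Tq/2. -/

section Bridge

variable {n : ℕ} {V : EuclideanSpace ℝ (Fin n) → ℝ}
  {b : EuclideanSpace ℝ (Fin n) → EuclideanSpace ℝ (Fin n)} {T q a : ℝ}
  {x y : EuclideanSpace ℝ (Fin n)}

theorem exists_steers_of_mem_pathsA {φ : ℝ → EuclideanSpace ℝ (Fin n)} (hT : 0 < T)
    (hφ : φ ∈ pathsA b T x y q) :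
    ∃ a, rateI V b T x φ = ENNReal.ofReal a ∧ Steers b (drift V b) T x y (T * q / 2) a := by
  obtain ⟨⟨⟨hac, hi⟩, hx⟩, hy, hq⟩ := hφ
  have hv : SqIntegrable T (deriv φ) :=
    (memLp_two_iff_integrable_sq_norm (aestronglyMeasurable_deriv _ _)).2
      ((intervalIntegrable_iff_integrableOn_Ioc_of_le hT.le).1 hi)
  have htraj : ∀ t ∈ uIcc 0 T, traj x (deriv φ) t = φ t := fun t ht ↦ by
    rw [hac.eq_add_integral_deriv (hv.intervalIntegrable hT.le) ht, hx, traj]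
  refine ⟨_, if_pos ⟨⟨hac, hi⟩, hx⟩, deriv φ, hv, ?_, ?_, ?_⟩
  · rw [htraj T right_mem_uIcc, hy]
  · rw [← hq, power, intervalIntegral.integral_congr
      (g := fun t ↦ inner ℝ (b (φ t)) (deriv φ t)) fun t ht ↦ by simp only [htraj t ht]]
    field_simp
  · rw [intervalIntegral.integral_congr
      (g := fun t ↦ ‖deriv φ t - drift V b (φ t)‖ ^ 2) fun t ht ↦ by simp only [htraj t ht]]

theorem Steers.exists_mem_pathsA (hT : 0 < T)
    (h : Steers b (drift V b) T x y (T * q / 2) a) :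
    ∃ φ ∈ pathsA b T x y q, rateI V b T x φ = ENNReal.ofReal a := by
  obtain ⟨v, hv, hy, hq, ha⟩ := h
  have hd : ∀ᵐ t, t ∈ uIoc 0 T → deriv (traj x v) t = v t := by
    filter_upwards [hv.hasDerivAt_traj hT.le x] with t ht ht'
    exact (ht ht').deriv
  have hi : IntervalIntegrable (fun t ↦ ‖deriv (traj x v) t‖ ^ 2) volume 0 T := by
    refine (hv.norm_sq hT.le).congr_ae ?_
    refine (ae_restrict_iff' measurableSet_uIoc).2 ?_
    filter_upwards [hd] with t ht ht'
    rw [ht ht']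
  have hmem : traj x v ∈ pathsHFrom T x :=
    ⟨⟨hv.absolutelyContinuous hT.le x, hi⟩, traj_zero x v⟩
  refine ⟨traj x v, ⟨hmem, hy, ?_⟩, ?_⟩
  · rw [power, intervalIntegral.integral_congr_ae
      (g := fun t ↦ inner ℝ (b (traj x v t)) (v t)), hq]
    · field_simp
    · filter_upwards [hd] with t ht ht'
      rw [ht ht']
  · rw [rateI, if_pos hmem, intervalIntegral.integral_congr_ae
      (g := fun t ↦ ‖v t - drift V b (traj x v t)‖ ^ 2), ha]
    filter_upwards [hd] with t ht ht'
    rw [ht ht']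

theorem rateSTo_le (hT : 0 < T) (h : Steers b (drift V b) T x y (T * q / 2) a) :
    rateSTo V b T x y q ≤ ENNReal.ofReal a := by
  obtain ⟨φ, hφ, hI⟩ := h.exists_mem_pathsA hT
  exact (iInf₂_le φ hφ).trans_eq hI

theorem le_rateSTo (hT : 0 < T) {m : ℝ}
    (h : ∀ a, Steers b (drift V b) T x y (T * q / 2) a → m ≤ a) :
    ENNReal.ofReal m ≤ rateSTo V b T x y q := by
  refine le_iInf₂ fun φ hφ ↦ ?_
  obtain ⟨a, ha, hs⟩ := exists_steers_of_mem_pathsA (V := V) hT hφ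
  rw [ha]
  exact ENNReal.ofReal_le_ofReal (h a hs)

end Bridge

/-! ### The cost function and the long-time rate of loops. -/

section Cost

variable {E : Type*} [NormedAddCommGroup E] [InnerProductSpace ℝ E] [FiniteDimensional ℝ E]
  [CompleteSpace E]

/-- The least action of the paths from `x` to `y` of duration `T` with circulation `Q`. -/
def cost (b c : E → E) (T : ℝ) (x y : E) (Q : ℝ) : ℝ := sInf {a | Steers b c T x y Q a}

variable {b c : E → E} {T S : ℝ} {x y z : E} {Q P a m : ℝ}

theorem cost_nonneg (hT : 0 ≤ T) : 0 ≤ cost b c T x y Q :=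
  Real.sInf_nonneg fun _ h ↦ Steers.nonneg h hT

theorem cost_le (hT : 0 ≤ T) (h : Steers b c T x y Q a) : cost b c T x y Q ≤ a :=
  csInf_le ⟨0, fun _ h ↦ Steers.nonneg h hT⟩ h

variable (hb : Continuous b) (hc : Continuous c)
  (hnc : ¬ ∃ U : E → ℝ, ∀ x, HasGradientAt U (b x) x)
include hb hc hnc

theorem exists_steers (hT : 0 < T) (x y : E) (Q : ℝ) : ∃ a, Steers b c T x y Q a := by
  obtain ⟨C, hC⟩ := exists_steers_bounded hb hc hnc (max ‖x‖ ‖y‖) hT T |Q|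
  obtain ⟨a, -, h⟩ := hC x y (le_max_left _ _) (le_max_right _ _) T ⟨le_rfl, le_rfl⟩ Q le_rfl
  exact ⟨a, h⟩

/-- Since `sInf ∅ = 0` in ℝ, a competitor is needed; controllability provides it. -/
theorem le_cost (hT : 0 < T) (h : ∀ a, Steers b c T x y Q a → m ≤ a) : m ≤ cost b c T x y Q :=
  le_csInf (exists_steers hb hc hnc hT x y Q) h

theorem cost_add_le (hT : 0 < T) (hS : 0 < S) :
    cost b c (T + S) x z (Q + P) ≤ cost b c T x y Q + cost b c S y z P := by
  rw [← sub_le_iff_le_add]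
  refine le_cost hb hc hnc hT fun a ha ↦ ?_
  rw [sub_le_comm]
  refine le_cost hb hc hnc hS fun a' ha' ↦ ?_
  linarith [cost_le (by positivity) (ha.trans hb hc hT.le hS.le ha')]

theorem exists_cost_le (R : ℝ) {r₀ : ℝ} (hr₀ : 0 < r₀) (r₁ M : ℝ) :
    ∃ C, ∀ x y : E, ‖x‖ ≤ R → ‖y‖ ≤ R → ∀ r ∈ Icc r₀ r₁, ∀ Q, |Q| ≤ M → cost b c r x y Q ≤ C := by
  obtain ⟨C, hC⟩ := exists_steers_bounded hb hc hnc R hr₀ r₁ M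
  refine ⟨C, fun x y hx hy r hr Q hQ ↦ ?_⟩
  obtain ⟨a, ha, h⟩ := hC x y hx hy r hr Q hQ
  exact (cost_le (hr₀.trans_le hr.1).le h).trans ha

theorem cost_iterate_le (hT : 0 < T) (N : ℕ) :
    cost b c ((N + 1) * T) x x ((N + 1) * Q) ≤ (N + 1) * cost b c T x x Q := by
  induction N with
  | zero => simp
  | succ N ih =>
    have h := cost_add_le hb hc hnc (T := (N + 1) * T) (S := T) (x := x) (y := x) (z := x)
      (Q := (N + 1) * Q) (P := Q) (by positivity) hT
    push_cast
    calc cost b c ((N + 1 + 1) * T) x x ((N + 1 + 1) * Q)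
        = cost b c ((N + 1) * T + T) x x ((N + 1) * Q + Q) := by congr 1 <;> ring
      _ ≤ _ := h
      _ ≤ _ := by linarith

/-- The long-time cost per unit time of loops is at most that of any given loop, uniformly in the
base point. -/
theorem exists_cost_div_le (hT : 0 < T) (y : E) (q R : ℝ) {ε : ℝ} (hε : 0 < ε) :
    ∃ T₁, 0 < T₁ ∧ ∀ S ≥ T₁, ∀ x : E, ‖x‖ ≤ R →
      cost b c S x x (S * q / 2) / S ≤ cost b c T y y (T * q / 2) / T + ε := by
  obtain ⟨C₁, hC₁⟩ := exists_cost_le hb hc hnc (max R ‖y‖) one_pos 1 0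
  obtain ⟨C₂, hC₂⟩ := exists_cost_le hb hc hnc (max R ‖y‖) one_pos (1 + T) ((2 + T) * |q| / 2)
  refine ⟨max (2 + T) (|C₁ + C₂| / ε), by positivity, fun S hS x hx ↦ ?_⟩
  have hS1 : 2 + T ≤ S := (le_max_left _ _).trans hS
  have hS2 : |C₁ + C₂| ≤ S * ε := (div_le_iff₀ hε).1 ((le_max_right _ _).trans hS)
  have hS0 : 0 < S := by linarith
  -- The time S splits into 1 to reach y, N + 1 laps of the given loop, and r ∈ [1, 1 + T] to
  -- return. The outward leg has circulation 0 and the return leg makes up the missing (1 + r)q/2.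
  obtain ⟨N, hN1, hN2⟩ : ∃ N : ℕ, (N + 1 : ℝ) * T ≤ S - 2 ∧ S - 2 ≤ (N + 2 : ℝ) * T := by
    have h1 : 1 ≤ ⌊(S - 2) / T⌋₊ := by
      rw [Nat.one_le_floor_iff, one_le_div hT]; linarith
    have h2 := Nat.floor_le (a := (S - 2) / T) (div_nonneg (by linarith) hT.le)
    have h3 := (Nat.lt_floor_add_one ((S - 2) / T)).le
    obtain ⟨N, hN⟩ := Nat.exists_eq_add_of_le' h1
    rw [hN] at h2 h3
    push_cast at h2 h3
    refine ⟨N, (le_div_iff₀ hT).1 h2, ?_⟩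
    have := (div_le_iff₀ hT).1 h3
    linarith
  set r : ℝ := S - 1 - (N + 1) * T
  have hr1 : 1 ≤ r := by simp only [r]; linarith
  have hr2 : r ≤ 1 + T := by simp only [r]; linarith
  have h1 := hC₁ x y (hx.trans (le_max_left _ _)) (le_max_right _ _) 1 ⟨le_rfl, le_rfl⟩ 0 (by simp)
  have h2 := hC₂ y x (le_max_right _ _) (hx.trans (le_max_left _ _)) r ⟨hr1, hr2⟩
    ((1 + r) * q / 2) (by
      rw [abs_div, abs_mul, abs_two, abs_of_pos (by linarith : 0 < 1 + r)]
      have : (1 + r) * |q| ≤ (2 + T) * |q| :=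
        mul_le_mul_of_nonneg_right (by linarith) (abs_nonneg q)
      linarith)
  have h3 := cost_iterate_le hb hc hnc (x := y) (Q := T * q / 2) hT N
  have hNT : 0 < (N + 1 : ℝ) * T := by positivity
  have h4 := cost_add_le hb hc hnc (x := x) (y := y) (z := y) (Q := 0)
    (P := (N + 1) * (T * q / 2)) one_pos hNT
  have h5 := cost_add_le hb hc hnc (x := x) (y := y) (z := x)
    (Q := 0 + (N + 1) * (T * q / 2)) (P := (1 + r) * q / 2)
    (by positivity : 0 < 1 + (N + 1 : ℝ) * T) (by linarith : 0 < r)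
  have h6 : cost b c S x x (S * q / 2) =
      cost b c (1 + (N + 1) * T + r) x x (0 + (N + 1) * (T * q / 2) + (1 + r) * q / 2) := by
    congr 1 <;> simp only [r] <;> ring
  have h7 : (N + 1 : ℝ) * cost b c T y y (T * q / 2) ≤ S * (cost b c T y y (T * q / 2) / T) := by
    have : 0 ≤ cost b c T y y (T * q / 2) / T := div_nonneg (cost_nonneg hT.le) hT.le
    calc (N + 1 : ℝ) * cost b c T y y (T * q / 2)
        = (N + 1) * T * (cost b c T y y (T * q / 2) / T) := by field_simp
      _ ≤ _ := by gcongr; linarith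
  rw [div_le_iff₀ hS0, h6]
  linarith [le_abs_self (C₁ + C₂)]

omit hb hc hnc in
/-- The long-time cost per unit time of the loops that dissipate the power `q`. -/
def loopRate (b c : E → E) (q : ℝ) : ℝ :=
  sInf ((fun T ↦ cost b c T 0 0 (T * q / 2) / T) '' Ioi 0)

omit hb hc hnc in
theorem loopRate_nonneg (q : ℝ) : 0 ≤ loopRate b c q := by
  refine Real.sInf_nonneg ?_
  rintro _ ⟨T, hT, rfl⟩
  exact div_nonneg (cost_nonneg (le_of_lt hT)) (le_of_lt hT)

/-- `loopRate` is defined with base point 0; long loops at 0 can imitate a loop at x up to ε. -/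
theorem loopRate_le (hT : 0 < T) (x : E) (q : ℝ) :
    loopRate b c q ≤ cost b c T x x (T * q / 2) / T := by
  refine le_of_forall_pos_le_add fun ε hε ↦ ?_
  obtain ⟨T₁, hT₁, h⟩ := exists_cost_div_le hb hc hnc hT x q 0 hε
  refine le_trans (csInf_le ⟨0, ?_⟩ ⟨T₁, hT₁, rfl⟩) (h T₁ le_rfl 0 (by simp))
  rintro _ ⟨T, hT, rfl⟩
  exact div_nonneg (cost_nonneg (le_of_lt hT)) (le_of_lt hT)

theorem exists_cost_div_le_loopRate (R q : ℝ) {ε : ℝ} (hε : 0 < ε) :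
    ∃ T₁, 0 < T₁ ∧ ∀ S ≥ T₁, ∀ x : E, ‖x‖ ≤ R →
      cost b c S x x (S * q / 2) / S ≤ loopRate b c q + ε := by
  obtain ⟨_, ⟨T, hT, rfl⟩, h⟩ := exists_lt_of_csInf_lt
    (nonempty_Ioi.image fun T ↦ cost b c T 0 0 (T * q / 2) / T)
    (lt_add_of_pos_right (loopRate b c q) (half_pos hε))
  obtain ⟨T₁, hT₁, h'⟩ := exists_cost_div_le hb hc hnc hT 0 q R (half_pos hε)
  refine ⟨T₁, hT₁, fun S hS x hx ↦ ?_⟩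
  have := h' S hS x hx
  simp only at h
  linarith

theorem tendsto_cost_div (x : E) (q : ℝ) :
    Tendsto (fun T ↦ cost b c T x x (T * q / 2) / T) atTop (𝓝 (loopRate b c q)) := by
  refine tendsto_order.2 ⟨fun a ha ↦ ?_, fun a ha ↦ ?_⟩
  · filter_upwards [eventually_gt_atTop 0] with T hT
    exact ha.trans_le (loopRate_le hb hc hnc hT x q)
  · obtain ⟨T₁, -, h⟩ := exists_cost_div_le_loopRate hb hc hnc ‖x‖ q (half_pos (sub_pos.2 ha))
    filter_upwards [eventually_ge_atTop T₁] with T hT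
    linarith [h T hT x le_rfl]

theorem convexOn_loopRate : ConvexOn ℝ univ (loopRate b c) := by
  refine convexOn_iff_forall_pos.2 ⟨convex_univ, fun p _ q _ l m hl hm hlm ↦ ?_⟩
  refine le_of_forall_pos_le_add fun ε hε ↦ ?_
  obtain ⟨T₁, hT₁, h₁⟩ := exists_cost_div_le_loopRate hb hc hnc 0 p hε
  obtain ⟨T₂, hT₂, h₂⟩ := exists_cost_div_le_loopRate hb hc hnc 0 q hε
  -- The loop of power p runs during lT and that of power q during mT, both long enough to be nearly
  -- optimal.
  set T := max (T₁ / l) (T₂ / m)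
  have hT : 0 < T := by positivity
  have hlT : T₁ ≤ l * T := (div_le_iff₀' hl).1 (le_max_left _ _)
  have hmT : T₂ ≤ m * T := (div_le_iff₀' hm).1 (le_max_right _ _)
  have hl0 : 0 < l * T := by positivity
  have hm0 : 0 < m * T := by positivity
  have h3 := (div_le_iff₀ hl0).1 (h₁ _ hlT 0 (by simp))
  have h4 := (div_le_iff₀ hm0).1 (h₂ _ hmT 0 (by simp))
  have h5 := cost_add_le hb hc hnc (x := 0) (y := 0) (z := 0) (Q := l * T * p / 2)
    (P := m * T * q / 2) hl0 hm0
  have h6 := loopRate_le hb hc hnc hT 0 (l • p + m • q)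
  have h7 : l * T + m * T = T := by rw [← add_mul, hlm, one_mul]
  rw [h7, show l * T * p / 2 + m * T * q / 2 = T * (l • p + m • q) / 2 by
    simp only [smul_eq_mul]; ring] at h5
  refine h6.trans ((div_le_iff₀ hT).2 ?_)
  have h8 : (l • loopRate b c p + m • loopRate b c q + ε) * T =
      (loopRate b c p + ε) * (l * T) + (loopRate b c q + ε) * (m * T) := by
    simp only [smul_eq_mul]
    linear_combination (-ε) * h7
  linarith

section Gradient

variable {V : E → ℝ} (hV : ContDiff ℝ 1 V)
  (hcV : ∀ z, c z = -((1 / 2 : ℝ) • ∇ V z) + b z)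
include hV hcV

theorem cost_neg (hT : 0 < T) : cost b c T x x (-Q) = cost b c T x x Q + 2 * Q := by
  have key : ∀ Q, cost b c T x x (-Q) ≤ cost b c T x x Q + 2 * Q := fun Q ↦ by
    rw [← sub_le_iff_le_add]
    refine le_cost hb hc hnc hT fun a ha ↦ ?_
    linarith [cost_le hT.le (ha.reverse_loop hV hb hcV hT.le)]
  have h := key (-Q)
  rw [neg_neg] at h
  linarith [key Q]

theorem loopRate_sub_loopRate_neg (q : ℝ) : loopRate b c q - loopRate b c (-q) = -q := by
  have h1 := (tendsto_cost_div hb hc hnc 0 q).add_const q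
  have h2 := tendsto_cost_div hb hc hnc 0 (-q)
  have h3 : (fun T ↦ cost b c T 0 0 (T * q / 2) / T + q) =ᶠ[atTop]
      fun T ↦ cost b c T 0 0 (T * -q / 2) / T := by
    filter_upwards [eventually_gt_atTop 0] with T hT
    rw [show T * -q / 2 = -(T * q / 2) by ring, cost_neg hb hc hnc hV hcV hT]
    field_simp
  linarith [tendsto_nhds_unique (h1.congr' h3) h2]

/-- Paths with free end point are asymptotically no cheaper than loops. -/
theorem exists_loopRate_sub_le {M m : ℝ} (hbM : ∀ x, ‖b x‖ ≤ M)
    (hm : ∀ x, m ≤ V x) (hcoer : ∀ W, ∃ R, ∀ x, R < ‖x‖ → W ≤ ‖c x‖ ^ 2) (R₀ q : ℝ) {δ : ℝ}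
    (hδ : 0 < δ) :
    ∃ T₀ η, 0 < η ∧ ∀ T ≥ T₀, ∀ x : E, ‖x‖ ≤ R₀ → ∀ q', |q' - q| ≤ η → ∀ y a,
      Steers b c T x y (T * q' / 2) a → T * (loopRate b c q - δ) ≤ a := by
  have hcont : Continuous (loopRate b c) :=
    (convexOn_loopRate hb hc hnc).locallyLipschitz.continuous
  obtain ⟨ρ, hρ, hρ'⟩ := Metric.continuousAt_iff.1 (hcont.continuousAt (x := q)) (δ / 4)
    (by positivity)
  set s := loopRate b c q
  have hs : 0 ≤ s := loopRate_nonneg q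
  -- The bounds ensure in turn that τ ≥ T/2, that the closed loop has power within ρ of q, and that
  -- the lost time fraction costs at most δ/4.
  set η := min (1 / 2) (min (ρ / (2 * (6 + 4 * |q|))) (δ / (4 * (s + 1))))
  have hη : 0 < η := by positivity
  have hη1 : η ≤ 1 / 2 := min_le_left _ _
  have hη2 : η * (6 + 4 * |q|) < ρ := by
    have h : η ≤ ρ / (2 * (6 + 4 * |q|)) := (min_le_right _ _).trans (min_le_left _ _)
    have := (le_div_iff₀ (by positivity)).1 h
    linarith
  have hη3 : η * s ≤ δ / 4 := by
    have h : η ≤ δ / (4 * (s + 1)) := (min_le_right _ _).trans (min_le_right _ _)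
    have := (le_div_iff₀ (by positivity)).1 h
    linarith
  obtain ⟨R, hR⟩ := exists_steers_truncation hV hb hcV hbM hm hcoer (s + |q| + 1) R₀ hη
    (by linarith)
  obtain ⟨C, hC⟩ := exists_cost_le hb hc hnc (max R R₀) one_pos 1 0
  -- Beyond this time the unit of time spent closing the path is at most ηT, and its cost C at most
  -- δT/4.
  refine ⟨max 1 (max (1 / η) (4 * C / δ)), η, hη, fun T hT x hx q' hq' y a ha ↦ ?_⟩
  have hT1 : 1 ≤ T := (le_max_left _ _).trans hT
  have hT2 : 1 ≤ T * η :=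
    (div_le_iff₀ hη).1 (((le_max_left _ _).trans (le_max_right _ _)).trans hT)
  have hT3 : 4 * C ≤ T * δ :=
    (div_le_iff₀ hδ).1 (((le_max_right _ _).trans (le_max_right _ _)).trans hT)
  by_contra! hcon
  have hq'' : |q'| ≤ |q| + 1 := by
    have := abs_add_le (q' - q) q
    rw [sub_add_cancel] at this
    linarith
  obtain ⟨τ, ⟨hτ1, hτ2⟩, y', Q', a', hy', hst, ha', hQ'⟩ := hR T hT1 x hx y _ a ha
    (by nlinarith [abs_nonneg q]) (by
      rw [abs_div, abs_mul, abs_two, abs_of_pos (by linarith)]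
      nlinarith [abs_nonneg q])
  have hτT : T / 2 ≤ τ := by nlinarith
  have hτ0 : 0 < τ := by linarith
  have h1 := hC y' x (hy'.trans (le_max_left _ _)) (hx.trans (le_max_right _ _)) 1 ⟨le_rfl, le_rfl⟩
    0 (by simp)
  have h2 := cost_add_le hb hc hnc (x := x) (y := y') (z := x) (Q := Q') (P := 0) hτ0 one_pos
  have h3 := cost_le hτ0.le hst
  -- 2Q'/(τ + 1) is the power of the loop closed up with zero circulation in one unit of time.
  have h4 := loopRate_le hb hc hnc (T := τ + 1) (by linarith) x (2 * Q' / (τ + 1))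
  rw [le_div_iff₀ (by linarith),
    show (τ + 1) * (2 * Q' / (τ + 1)) / 2 = Q' + 0 by field_simp; ring] at h4
  have h5 : |2 * Q' / (τ + 1) - q| < ρ := by
    have e : 2 * Q' / (τ + 1) - q =
        (-2 * (T * q' / 2 - Q') + T * (q' - q) + (T - τ - 1) * q) / (τ + 1) := by
      field_simp; ring
    have e1 : |(T - τ - 1) * q| ≤ 2 * η * T * |q| := by
      rw [abs_mul]
      gcongr
      rw [abs_le]
      constructor <;> nlinarith
    have e2 : |T * (q' - q)| ≤ η * T := by
      rw [abs_mul, abs_of_pos (by linarith)]; nlinarith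
    have e3 : |-2 * (T * q' / 2 - Q')| ≤ 2 * (η * T) := by
      rw [abs_mul, abs_neg, abs_two]; gcongr
    rw [e, abs_div, abs_of_pos (by linarith : 0 < τ + 1), div_lt_iff₀ (by linarith)]
    calc _ ≤ 2 * (η * T) + η * T + 2 * η * T * |q| :=
          (abs_add_three _ _ _).trans (add_le_add (add_le_add e3 e2) e1)
      _ = η * (6 + 4 * |q|) * (T / 2) := by ring
      _ ≤ ρ * (T / 2) := by gcongr
      _ < ρ * (τ + 1) := by gcongr; linarith
  have h6 := (abs_lt.1 (hρ' h5)).1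
  have h7 := loopRate_nonneg (b := b) (c := c) (2 * Q' / (τ + 1))
  have h8 : (1 - η) * T * loopRate b c (2 * Q' / (τ + 1)) ≤
      loopRate b c (2 * Q' / (τ + 1)) * (τ + 1) := by
    rw [mul_comm]; gcongr; linarith
  have h9 : (1 - η) * T * (s - δ / 4) ≤ (1 - η) * T * loopRate b c (2 * Q' / (τ + 1)) := by
    have : 0 ≤ (1 - η) * T := mul_nonneg (by linarith) (by linarith)
    gcongr
    linarith
  -- It follows that a + C ≥ T(s - δ/2); with C ≤ δT/4 this contradicts a < T(s - δ).
  have h10 : T * (s - δ / 2) ≤ (1 - η) * T * (s - δ / 4) := by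
    have : 0 ≤ T * (δ / 4 - η * s + η * δ / 4) := by
      refine mul_nonneg (by linarith) ?_
      have : 0 ≤ η * δ := by positivity
      linarith
    linarith
  nlinarith

end Gradient

end Cost

/-! ### Transfer to the extended-valued rate functions, and Γ-convergence. -/

section Main

variable {n : ℕ} {V : EuclideanSpace ℝ (Fin n) → ℝ}
  {b : EuclideanSpace ℝ (Fin n) → EuclideanSpace ℝ (Fin n)}

theorem ConditionA.continuous_drift (hA : ConditionA V) (hB : ConditionB b) :
    Continuous (drift V b) := by
  have h1 := continuous_gradient (hA.contDiff.of_le one_le_two)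
  have h2 := hB.contDiff.continuous
  unfold drift
  fun_prop

theorem rateSTo_eq_cost (hA : ConditionA V) (hB : ConditionB b) {T : ℝ} (hT : 0 < T)
    (x y : EuclideanSpace ℝ (Fin n)) (q : ℝ) :
    rateSTo V b T x y q = ENNReal.ofReal (cost b (drift V b) T x y (T * q / 2)) := by
  have hb := hB.contDiff.continuous
  have hc := hA.continuous_drift hB
  refine le_antisymm ?_ (le_rateSTo hT fun a ha ↦ cost_le hT.le ha)
  obtain ⟨a, ha⟩ := exists_steers hb hc hB.not_conservative hT x y (T * q / 2)
  have htop : rateSTo V b T x y q ≠ ⊤ := ((rateSTo_le hT ha).trans_lt ENNReal.ofReal_lt_top).ne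
  rw [← ENNReal.ofReal_toReal htop]
  refine ENNReal.ofReal_le_ofReal (le_cost hb hc hB.not_conservative hT fun a ha ↦ ?_)
  exact ENNReal.toReal_le_of_le_ofReal (ha.nonneg hT.le) (rateSTo_le hT ha)

theorem rateSTo_div_eq_cost (hA : ConditionA V) (hB : ConditionB b) {T : ℝ} (hT : 0 < T)
    (x y : EuclideanSpace ℝ (Fin n)) (q : ℝ) :
    rateSTo V b T x y q / ENNReal.ofReal T =
      ENNReal.ofReal (cost b (drift V b) T x y (T * q / 2) / T) := by
  rw [rateSTo_eq_cost hA hB hT, ENNReal.ofReal_div_of_pos hT]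

theorem tendsto_rateSTo_div (hA : ConditionA V) (hB : ConditionB b)
    (x : EuclideanSpace ℝ (Fin n)) (q : ℝ) :
    Tendsto (fun T : ℝ ↦ rateSTo V b T x x q / ENNReal.ofReal T) atTop
      (𝓝 (ENNReal.ofReal (loopRate b (drift V b) q))) := by
  refine (ENNReal.tendsto_ofReal (tendsto_cost_div hB.contDiff.continuous
    (hA.continuous_drift hB) hB.not_conservative x q)).congr' ?_
  filter_upwards [eventually_gt_atTop 0] with T hT
  rw [rateSTo_div_eq_cost hA hB hT]

theorem rateInf_eq_loopRate (hA : ConditionA V) (hB : ConditionB b)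
    (x : EuclideanSpace ℝ (Fin n)) (q : ℝ) :
    rateInf V b x q = ENNReal.ofReal (loopRate b (drift V b) q) := by
  refine le_antisymm ?_ (le_iInf₂ fun T hT ↦ ?_)
  · refine ge_of_tendsto (tendsto_rateSTo_div hA hB x q) ?_
    filter_upwards [eventually_gt_atTop 0] with T hT
    exact iInf₂_le T hT
  · rw [rateSTo_div_eq_cost hA hB hT]
    exact ENNReal.ofReal_le_ofReal (loopRate_le hB.contDiff.continuous
      (hA.continuous_drift hB) hB.not_conservative hT x q)

theorem rateS_le_rateSTo (T : ℝ) (x : EuclideanSpace ℝ (Fin n)) (q : ℝ) :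
    rateS V b T x q ≤ rateSTo V b T x x q :=
  iInf_le _ x

theorem gammaConverges_rateS (hA : ConditionA V) (hB : ConditionB b) {R : ℝ}
    {x : ℕ → EuclideanSpace ℝ (Fin n)} (hx : ∀ k, ‖x k‖ ≤ R) {τ : ℕ → ℝ} (hτ : ∀ k, 0 < τ k)
    (hτ' : Tendsto τ atTop atTop) :
    GammaConverges (fun k q ↦ rateS V b (τ k) (x k) q / ENNReal.ofReal (τ k))
      (fun q ↦ ENNReal.ofReal (loopRate b (drift V b) q)) := by
  have hb := hB.contDiff.continuous
  have hc := hA.continuous_drift hB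
  obtain ⟨M, hM⟩ := hB.bounded
  obtain ⟨m, hm⟩ := hA.exists_lower_bound
  intro q
  refine ⟨fun u hu ↦ ?_, fun _ ↦ q, tendsto_const_nhds, ?_⟩
  -- The lower bound is proved with a loss δ and passes to the limit δ → 0.
  · have hlim : Tendsto (fun δ : ℝ ↦ ENNReal.ofReal (loopRate b (drift V b) q - δ)) (𝓝[>] 0)
        (𝓝 (ENNReal.ofReal (loopRate b (drift V b) q))) := by
      refine ENNReal.tendsto_ofReal (Tendsto.mono_left ?_ nhdsWithin_le_nhds)
      have : Continuous fun δ : ℝ ↦ loopRate b (drift V b) q - δ := by fun_prop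
      simpa using this.tendsto 0
    refine le_of_tendsto hlim (eventually_mem_nhdsWithin.mono fun δ hδ ↦ ?_)
    obtain ⟨T₀, η, hη, h⟩ := exists_loopRate_sub_le hb hc hB.not_conservative
      (hA.contDiff.of_le one_le_two) (fun _ ↦ rfl) hM hm
      (hA.exists_le_norm_drift_sq hM) R q (mem_Ioi.1 hδ)
    refine le_liminf_of_le (by isBoundedDefault) ?_
    filter_upwards [hτ'.eventually_ge_atTop T₀, hu.eventually (Metric.closedBall_mem_nhds q hη)]
      with k hk hk'
    rw [ENNReal.le_div_iff_mul_le (Or.inl (by simpa using hτ k)) (Or.inl ENNReal.ofReal_ne_top),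
      mul_comm, ← ENNReal.ofReal_mul (hτ k).le]
    exact le_iInf fun y ↦ le_rateSTo (hτ k) fun a ha ↦ h _ hk _ (hx k) _ hk' y a ha
  · refine ENNReal.le_of_forall_pos_le_add fun ε hε _ ↦ ?_
    obtain ⟨T₁, -, h⟩ := exists_cost_div_le_loopRate hb hc hB.not_conservative R q
      (NNReal.coe_pos.2 hε)
    refine limsup_le_of_le (by isBoundedDefault) ?_
    filter_upwards [hτ'.eventually_ge_atTop T₁] with k hk
    refine (ENNReal.div_le_div_right (rateS_le_rateSTo _ _ _) _).trans ?_
    rw [rateSTo_div_eq_cost hA hB (hτ k), ← ENNReal.ofReal_coe_nnreal,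
      ← ENNReal.ofReal_add (loopRate_nonneg q) ε.coe_nonneg]
    exact ENNReal.ofReal_le_ofReal (h _ hk _ (hx k))

end Main

end GallavottiCohen

end

/- The orthogonality `hC` is not needed: the cost `(1/2) ∫ (|φ'|² + |c(φ)|²)` is invariant under
time reversal whether or not `∇V` and `b` are orthogonal. -/
theorem mainTheorem4 {n : ℕ} (V : EuclideanSpace ℝ (Fin n) → ℝ)
    (b : EuclideanSpace ℝ (Fin n) → EuclideanSpace ℝ (Fin n))
    (hA : GallavottiCohen.ConditionA V) (hB : GallavottiCohen.ConditionB b)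
    (hC : GallavottiCohen.ConditionC V b) :
    ∃ s : ℝ → ℝ,
      (∀ q, 0 ≤ s q) ∧
      -- (i): `s^x` is finite, does not depend on `x`, and its common value `s` is convex
      (∀ (x : EuclideanSpace ℝ (Fin n)) (q : ℝ),
        GallavottiCohen.rateInf V b x q = ENNReal.ofReal (s q)) ∧
      ConvexOn ℝ Set.univ s ∧
      -- `s(q) = lim_{T → ∞} S^{xx}_T(q) / T`
      (∀ (x : EuclideanSpace ℝ (Fin n)) (q : ℝ),
        Tendsto (fun T : ℝ => GallavottiCohen.rateSTo V b T x x q / ENNReal.ofReal T)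
          atTop (𝓝 (ENNReal.ofReal (s q)))) ∧
      -- the fluctuation theorem
      (∀ q, s q - s (-q) = -q) ∧
      -- (ii): for a bounded family `x_T`, the functions `s_T` are finite and `Γ`-converge to `s`
      (∀ x : ℝ → EuclideanSpace ℝ (Fin n), Bornology.IsBounded (x '' Set.Ioi 0) →
        (∀ T : ℝ, 0 < T → ∀ q : ℝ,
          GallavottiCohen.rateS V b T (x T) q / ENNReal.ofReal T < ⊤) ∧
        (∀ τ : ℕ → ℝ, (∀ k, 0 < τ k) → Tendsto τ atTop atTop →
          GallavottiCohen.GammaConverges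
            (fun k q => GallavottiCohen.rateS V b (τ k) (x (τ k)) q / ENNReal.ofReal (τ k))
            (fun q => ENNReal.ofReal (s q)))) := by
  open GallavottiCohen in
  have hb := hB.contDiff.continuous
  have hc := hA.continuous_drift hB
  refine ⟨loopRate b (drift V b), loopRate_nonneg, rateInf_eq_loopRate hA hB,
    convexOn_loopRate hb hc hB.not_conservative, tendsto_rateSTo_div hA hB,
    loopRate_sub_loopRate_neg hb hc hB.not_conservative (hA.contDiff.of_le one_le_two)
      (fun _ ↦ rfl), fun x hx ↦ ⟨fun T hT q ↦ ?_, fun τ hτ hτ' ↦ ?_⟩⟩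
  · refine (ENNReal.div_le_div_right (rateS_le_rateSTo _ _ _) _).trans_lt ?_
    rw [rateSTo_div_eq_cost hA hB hT]
    exact ENNReal.ofReal_lt_top
  · obtain ⟨R, hR⟩ := isBounded_iff_forall_norm_le.1 hx
    exact gammaConverges_rateS hA hB (fun k ↦ hR _ ⟨τ k, hτ k, rfl⟩) hτ hτ'
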